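/- Let $(\Omega,\mathcal F)$ be a measurable space, $p(x,dy)$ a Markov kernel on it which is reversible with respect to a probability measure $\pi$, i.e. $\pi(dx)p(x,dy)=\pi(dy)p(y,dx)$, and suppose that $0<\pi(A)<1$ for at least one $A\in\mathcal F$. Let $Pf(x)=\int f(y)\,p(x,dy)$ on $L^2(\pi)$ (real or complex), and let $L^2_0(\pi)=\{f\in L^2(\pi):\int f\,d\pi=0\}$, which is invariant under $P$. For $n\ge 1$ and $A\in\mathcal F$ with $0<\pi(A)<1$ put $$k_n(A)=\frac{1}{\pi(A)\pi(A^c)}\int_A p^n(x,A^c)\,\pi(dx),\qquad k_n=\inf_{A} k_n(A),\qquad k=k_1,\qquad K=\sup_A k_1(A),$$ where $p^n$ is the $n$-step transition kernel and the infimum and the supremum are over all $A\in\mathcal F$ with $0<\pi(A)<1$. We say that $P$ has an $L^2$-spectral gap if there is $r>0$ such that, for every $f\in L^2_0(\pi)$ with $\|f\|_2=1$, the limit $\lim_{n\to\infty}\|P^nf\|_2^{1/n}$ exists and is at most $1-r$. There is a universal constant $\kappa>1$ (depending neither on the state space nor on the chain) such that the following holds for all such chains. (a) The following three conditions are equivalent: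 (1) $P$ has an $L^2$-spectral gap; (2) $0<k\le K<2$; (3) $k_2>0$. (b) $\frac{\kappa}{8}k_2^2\le 1$, and the spectrum of the restriction of $P$ to $L^2_0(\pi)$ satisfies $$\sigma\big(P|_{L^2_0(\pi)}\big)\subset\left[-\sqrt{1-\tfrac{\kappa}{8}k_2^2},\ \min\Big(\sqrt{1-\tfrac{\kappa}{8}k_2^2},\ 1-\tfrac{\kappa}{8}k^2\Big)\right].$$ (c) $$k_2\ \ge\ \sup_{\delta,\epsilon_1,\epsilon_2,\epsilon\in(0,1)}\min\left[\frac{k^2}{16}\delta,\ \frac k4\big(\epsilon_1\epsilon_2(1-\delta)-\delta\big),\ \left(k\Big(\frac{(2-\epsilon)(1-\epsilon_1)(1-\epsilon_2)(1-\delta)}{(1-\epsilon)K}-\frac1{1-\epsilon}\Big)-\frac{\epsilon}{1-\epsilon}\right)\epsilon\right]$$ (if $K=0$, then also $k=0$ and the third term is read as $-\epsilon^2/(1-\epsilon)$). -/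

import Mathlib

open MeasureTheory ProbabilityTheory Filter Topology
open scoped ENNReal

namespace ReversibleChain

noncomputable section

variable {Ω : Type*} [MeasurableSpace Ω]

/-! ### Isoperimetric constants -/

/-- `kₙ(A) = (π(A) π(Aᶜ))⁻¹ ∫_A pⁿ(x, Aᶜ) π(dx)`, where `pⁿ` is the `n`-step transition kernel. -/
def flow (p : Kernel Ω Ω) (π : Measure Ω) (n : ℕ) (A : Set Ω) : ℝ :=
  1 / (π.real A * π.real Aᶜ) * ∫ x in A, ((p ^ n : Kernel Ω Ω) x).real Aᶜ ∂π

/-- The measurable sets `A` with `0 < π(A) < 1`, i.e. those for which `kₙ(A)` makes sense. -/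
def properSets (π : Measure Ω) : Set (Set Ω) :=
  {A | MeasurableSet A ∧ 0 < π A ∧ π A < 1}

/-- `kₙ = inf_A kₙ(A)`; in particular `k = k₁`. -/
def isoConst (p : Kernel Ω Ω) (π : Measure Ω) (n : ℕ) : ℝ :=
  sInf (flow p π n '' properSets π)

/-- `K = sup_A k(A)`. -/
def supConst (p : Kernel Ω Ω) (π : Measure Ω) : ℝ :=
  sSup (flow p π 1 '' properSets π)

/-! ### The Markov operator on `L²(π)` -/

section Operator

variable {𝕜 : Type*} [RCLike 𝕜]

/-- Jensen's inequality `‖∫ f(y) p(x,dy)‖² ≤ ∫ ‖f(y)‖² p(x,dy)`. -/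
lemma enorm_integral_sq_le (ν : Measure Ω) [IsProbabilityMeasure ν] {f : Ω → 𝕜}
    (hf : StronglyMeasurable f) :
    ‖∫ y, f y ∂ν‖ₑ ^ (2 : ℝ) ≤ ∫⁻ y, ‖f y‖ₑ ^ (2 : ℝ) ∂ν := by
  have h1 : ‖∫ y, f y ∂ν‖ₑ ≤ eLpNorm f 2 ν := by
    refine (enorm_integral_le_lintegral_enorm f).trans ?_
    rw [← eLpNorm_one_eq_lintegral_enorm]
    exact eLpNorm_le_eLpNorm_of_exponent_le (by norm_num) hf.aestronglyMeasurable
  have h2 := ENNReal.rpow_le_rpow h1 (show (0 : ℝ) ≤ 2 by norm_num)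
  refine h2.trans (le_of_eq ?_)
  rw [eLpNorm_eq_lintegral_rpow_enorm_toReal (by norm_num) (by norm_num), ← ENNReal.rpow_mul]
  simp

variable {p : Kernel Ω Ω} {π : Measure Ω}

lemma eLpNorm_kernel_le [IsMarkovKernel p] (h : p.Invariant π)
    {f : Ω → 𝕜} (hf : StronglyMeasurable f) :
    eLpNorm (fun x => ∫ y, f y ∂(p x)) 2 π ≤ eLpNorm f 2 π := by
  rw [eLpNorm_eq_lintegral_rpow_enorm_toReal (by norm_num) (by norm_num),
    eLpNorm_eq_lintegral_rpow_enorm_toReal (by norm_num) (by norm_num)]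
  refine ENNReal.rpow_le_rpow ?_ (by positivity)
  have hm : Measurable (fun y => ‖f y‖ₑ ^ (2 : ℝ)) := hf.enorm.pow_const _
  calc ∫⁻ x, ‖∫ y, f y ∂(p x)‖ₑ ^ (2 : ℝ≥0∞).toReal ∂π
      ≤ ∫⁻ x, ∫⁻ y, ‖f y‖ₑ ^ (2 : ℝ) ∂(p x) ∂π :=
        lintegral_mono fun x => by simpa using enorm_integral_sq_le (p x) hf
    _ = ∫⁻ y, ‖f y‖ₑ ^ (2 : ℝ) ∂(π.bind p) :=
        (Measure.lintegral_bind p.aemeasurable hm.aemeasurable).symm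
    _ = ∫⁻ y, ‖f y‖ₑ ^ (2 : ℝ≥0∞).toReal ∂π := by rw [h.def]; simp

lemma memLp_kernel [IsMarkovKernel p] (h : p.Invariant π) (f : Lp 𝕜 2 π) :
    MemLp (fun x => ∫ y, f y ∂(p x)) 2 π :=
  ⟨((Lp.stronglyMeasurable f).integral_kernel (κ := p)).aestronglyMeasurable,
    (eLpNorm_kernel_le h (Lp.stronglyMeasurable f)).trans_lt (Lp.memLp f).2⟩

lemma ae_kernel (h : p.Invariant π) {q : Ω → Prop} (hq : ∀ᵐ y ∂π, q y) :
    ∀ᵐ x ∂π, ∀ᵐ y ∂(p x), q y := by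
  refine Measure.ae_ae_of_ae_comp ?_
  rwa [h.def]

lemma ae_integrable_kernel [IsFiniteMeasure π] (h : p.Invariant π) (f : Lp 𝕜 2 π) :
    ∀ᵐ x ∂π, Integrable f (p x) := by
  have hint : Integrable f π := (Lp.memLp f).integrable (by norm_num)
  have hm : Measurable (fun y => ‖f y‖ₑ) := (Lp.stronglyMeasurable f).enorm
  have hfin : ∫⁻ x, ∫⁻ y, ‖f y‖ₑ ∂(p x) ∂π ≠ ∞ := by
    rw [← Measure.lintegral_bind p.aemeasurable hm.aemeasurable, h.def]
    exact hint.2.ne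
  filter_upwards [ae_lt_top hm.lintegral_kernel hfin] with x hx
  exact ⟨(Lp.stronglyMeasurable f).aestronglyMeasurable, hx⟩

/-- The operator `P f (x) = ∫ f(y) p(x,dy)` on `L²(π)` (with values in `𝕜 = ℝ` or `ℂ`) of a Markov
kernel `p` with invariant probability measure `π`. -/
def markovOp (𝕜 : Type*) [RCLike 𝕜] [IsMarkovKernel p] [IsProbabilityMeasure π]
    (h : p.Invariant π) : Lp 𝕜 2 π →L[𝕜] Lp 𝕜 2 π :=
  LinearMap.mkContinuous
    { toFun := fun f => (memLp_kernel h f).toLp (fun x => ∫ y, f y ∂(p x))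
      map_add' := fun f g => by
        rw [← MemLp.toLp_add, MemLp.toLp_eq_toLp_iff]
        filter_upwards [ae_kernel h (Lp.coeFn_add f g), ae_integrable_kernel h f,
          ae_integrable_kernel h g] with x hx hf hg
        rw [integral_congr_ae hx]
        exact integral_add hf hg
      map_smul' := fun c f => by
        rw [RingHom.id_apply, ← MemLp.toLp_const_smul, MemLp.toLp_eq_toLp_iff]
        filter_upwards [ae_kernel h (Lp.coeFn_smul c f)] with x hx
        rw [integral_congr_ae hx]
        exact integral_smul c f }
    1 (fun f => by
      rw [one_mul, LinearMap.coe_mk, AddHom.coe_mk, Lp.norm_toLp, Lp.norm_def]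
      exact ENNReal.toReal_mono (Lp.memLp f).2.ne
        (eLpNorm_kernel_le h (Lp.stronglyMeasurable f)))

lemma markovOp_coeFn [IsMarkovKernel p] [IsProbabilityMeasure π] (h : p.Invariant π)
    (f : Lp 𝕜 2 π) : markovOp 𝕜 h f =ᵐ[π] fun x => ∫ y, f y ∂(p x) :=
  (memLp_kernel h f).coeFn_toLp

/-- `L²₀(π)`: the functions in `L²(π)` with mean zero. -/
def L2Zero (𝕜 : Type*) [RCLike 𝕜] (π : Measure Ω) [IsProbabilityMeasure π] :
    Submodule 𝕜 (Lp 𝕜 2 π) where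
  carrier := {f | ∫ x, f x ∂π = 0}
  zero_mem' := by simp
  add_mem' := fun {f g} hf hg => by
    have hi (u : Lp 𝕜 2 π) : Integrable u π := (Lp.memLp u).integrable (by norm_num)
    have h1 : ∫ x, (f + g) x ∂π = ∫ x, f x ∂π + ∫ x, g x ∂π :=
      (integral_congr_ae (Lp.coeFn_add f g)).trans (integral_add (hi f) (hi g))
    simp only [Set.mem_ofPred_eq] at hf hg ⊢
    rw [h1, hf, hg, add_zero]
  smul_mem' := fun c f hf => by
    have h1 : ∫ x, (c • f) x ∂π = c • ∫ x, f x ∂π :=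
      (integral_congr_ae (Lp.coeFn_smul c f)).trans (integral_smul c f)
    simp only [Set.mem_ofPred_eq] at hf ⊢
    rw [h1, hf, smul_zero]

lemma markovOp_mem_L2Zero [IsMarkovKernel p] [IsProbabilityMeasure π] (h : p.Invariant π)
    (f : Lp 𝕜 2 π) (hf : f ∈ L2Zero 𝕜 π) : markovOp 𝕜 h f ∈ L2Zero 𝕜 π := by
  have hc : (p ∘ₖ Kernel.const Unit π) () = π := by
    rw [Kernel.comp_apply, Kernel.const_apply, h.def]
  have hint : Integrable f ((p ∘ₖ Kernel.const Unit π) ()) := by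
    rw [hc]; exact (Lp.memLp f).integrable (by norm_num)
  have h2 := Kernel.integral_comp hint
  rw [hc, Kernel.const_apply] at h2
  have h1 : ∫ x, markovOp 𝕜 h f x ∂π = ∫ x, f x ∂π := by
    rw [integral_congr_ae (markovOp_coeFn h f), ← h2]
  exact h1.trans hf

/-- The restriction of `P` to `L²₀(π)`. -/
def markovOpZero (𝕜 : Type*) [RCLike 𝕜] [IsMarkovKernel p] [IsProbabilityMeasure π]
    (h : p.Invariant π) : L2Zero 𝕜 π →L[𝕜] L2Zero 𝕜 π :=
  (markovOp 𝕜 h).restrict (markovOp_mem_L2Zero h)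

/-- `P` has an `L²`-spectral gap: there is `r > 0` such that
`lim ‖Pⁿ f‖₂^(1/n)` exists and is at most `1 - r` for all `f` of mean zero and norm one. -/
def HasSpectralGap (𝕜 : Type*) [RCLike 𝕜] [IsMarkovKernel p] [IsProbabilityMeasure π]
    (h : p.Invariant π) : Prop :=
  ∃ r : ℝ, 0 < r ∧ ∀ f ∈ L2Zero 𝕜 π, ‖f‖ = 1 →
    ∃ l : ℝ, l ≤ 1 - r ∧
      Tendsto (fun n : ℕ => ‖(markovOp 𝕜 h ^ n) f‖ ^ (1 / (n : ℝ))) atTop (𝓝 l)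

end Operator

/-! ### The lower bound for `k₂` -/

/-- The minimum of the three quantities that bound `k₂` from below. -/
def lowerTerm (k K δ ε₁ ε₂ ε : ℝ) : ℝ :=
  min (k ^ 2 / 16 * δ) (min (k / 4 * (ε₁ * ε₂ * (1 - δ) - δ))
    ((k * ((2 - ε) * (1 - ε₁) * (1 - ε₂) * (1 - δ) / ((1 - ε) * K) - 1 / (1 - ε))
      - ε / (1 - ε)) * ε))

/-- The values of these minima over all parameters `δ, ε₁, ε₂, ε` in the open interval `(0,1)`. -/
def lowerTerms (k K : ℝ) : Set ℝ :=
  {t | ∃ δ ∈ Set.Ioo (0 : ℝ) 1, ∃ ε₁ ∈ Set.Ioo (0 : ℝ) 1, ∃ ε₂ ∈ Set.Ioo (0 : ℝ) 1,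
    ∃ ε ∈ Set.Ioo (0 : ℝ) 1, t = lowerTerm k K δ ε₁ ε₂ ε}

end

end ReversibleChain

namespace ReversibleChain

section Edge

variable {Ω : Type*} [MeasurableSpace Ω] {π : Measure Ω} [IsProbabilityMeasure π]
  {q : Kernel Ω Ω} [IsMarkovKernel q]

/-! ### The edge measure `π(dx) q(x, dy)` -/

/-! Everything is read off the edge measure `π ⊗ₘ q`, which reversibility makes symmetric; `k(A)
π(A) π(Aᶜ)` is its mass on `A ×ˢ Aᶜ`.

Upper bounds. A Cheeger inequality (`cheeger_real`: layer cake plus Cauchy–Schwarz) gives `⟨f, Pf⟩ ≤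
(1 - κk²/8)‖f‖²` for `f` of mean zero, with `κ = 36/25`. For the two-step kernel `⟨f, P²f⟩ = ‖Pf‖²`,
so the same inequality yields `‖Pf‖ ≤ √(1 - κk₂²/8) ‖f‖`. The two bounds enclose the numerical
range, hence the spectrum, and the second one turns `k₂ > 0` into a gap.

From a gap to `0 < k ≤ K < 2`. Since `P` is symmetric, `n ↦ ‖Pⁿf‖` is log-convex, so the limit of
the roots dominates `‖Pf‖` and a gap is a norm bound (`exists_tendsto_norm_pow_rpow`). It is tested
on `1_A - π(A)`.

Lower bound for `k₂` (`lowerTerms_le`), which also gives `k₂ > 0` from the condition on `k` and `K`.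
If the two-step flow out of `A` is tiny, almost every point jumps nearly surely into `A` or nearly
surely into `Aᶜ`. Let `B` be the points of the first kind. Then `A ∆ B` has almost no outflow and
mass about `2 k(A) π(A) π(Aᶜ)`. As `k > 0`, it must have nearly full mass: the chain almost
alternates between `A` and `Aᶜ`. Since `π(A) π(Aᶜ) ≤ 1/4`, this pushes `k(A)` towards 2, against `K
< 2`. -/

lemma map_swap_compProd (h : q.IsReversible π) : (π ⊗ₘ q).map Prod.swap = π ⊗ₘ q := by
  have : IsFiniteMeasure ((π ⊗ₘ q).map Prod.swap) := by
    infer_instance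
  refine Measure.ext_prod fun {s t} hs ht => ?_
  rw [Measure.map_apply measurable_swap (hs.prod ht), Set.preimage_swap_prod,
    Measure.compProd_apply_prod ht hs, Measure.compProd_apply_prod hs ht, h ht hs]

lemma edge_measurePreserving_swap (h : q.IsReversible π) :
    MeasurePreserving Prod.swap (π ⊗ₘ q) (π ⊗ₘ q) :=
  ⟨measurable_swap, map_swap_compProd h⟩

lemma edge_measurePreserving_fst : MeasurePreserving Prod.fst (π ⊗ₘ q) π :=
  ⟨measurable_fst, Measure.fst_compProd π q⟩

lemma edge_measurePreserving_snd (h : q.IsReversible π) :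
    MeasurePreserving Prod.snd (π ⊗ₘ q) π :=
  edge_measurePreserving_fst.comp (edge_measurePreserving_swap h)

lemma edge_real_prod_comm (h : q.IsReversible π) {A B : Set Ω} (hA : MeasurableSet A)
    (hB : MeasurableSet B) : (π ⊗ₘ q).real (A ×ˢ B) = (π ⊗ₘ q).real (B ×ˢ A) := by
  rw [measureReal_def, measureReal_def, Measure.compProd_apply_prod hA hB,
    Measure.compProd_apply_prod hB hA, h hA hB]

lemma setIntegral_kernel_real {A B : Set Ω} (hA : MeasurableSet A) (hB : MeasurableSet B) :
    ∫ x in A, (q x).real B ∂π = (π ⊗ₘ q).real (A ×ˢ B) := by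
  rw [measureReal_def, Measure.compProd_apply_prod hA hB]
  exact integral_toReal (q.measurable_coe hB).aemeasurable (ae_of_all _ fun x => measure_lt_top _ _)

lemma edge_real_prod_univ {A : Set Ω} (hA : MeasurableSet A) :
    (π ⊗ₘ q).real (A ×ˢ Set.univ) = π.real A := by
  rw [← setIntegral_kernel_real hA .univ]; simp

/-- A two-step path is seen from its midpoint: reversing the first step makes both steps leave the
same point. -/
lemma setLIntegral_sq_apply (h : q.IsReversible π) {A B : Set Ω} (hA : MeasurableSet A)
    (hB : MeasurableSet B) :
    ∫⁻ x in A, (q ^ 2 : Kernel Ω Ω) x B ∂π = ∫⁻ x, q x A * q x B ∂π := by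
  have hmB : Measurable fun x => q x B := q.measurable_coe hB
  have h1 : ∫⁻ z, A.indicator (fun _ => (1 : ℝ≥0∞)) z.1 * q z.2 B ∂(π ⊗ₘ q)
      = ∫⁻ x in A, (q ^ 2 : Kernel Ω Ω) x B ∂π := by
    rw [Measure.lintegral_compProd (by fun_prop (disch := assumption)), ← lintegral_indicator hA]
    refine lintegral_congr fun x => ?_
    by_cases hx : x ∈ A
    · simp [hx, Kernel.pow_succ_apply_eq_lintegral q 1 x hB]
    · simp [hx]
  rw [← h1, ← (edge_measurePreserving_swap h).lintegral_comp (by fun_prop (disch := assumption)),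
    Measure.lintegral_compProd (by
      simp only [Prod.fst_swap, Prod.snd_swap]; fun_prop (disch := assumption))]
  refine lintegral_congr fun x => ?_
  simp only [Prod.fst_swap, Prod.snd_swap]
  rw [lintegral_mul_const _ (by fun_prop (disch := assumption)), lintegral_indicator_const hA,
    one_mul]

lemma isReversible_sq (h : q.IsReversible π) : (q ^ 2 : Kernel Ω Ω).IsReversible π := by
  intro A B hA hB
  rw [setLIntegral_sq_apply h hA hB, setLIntegral_sq_apply h hB hA]
  simp_rw [mul_comm]

instance isMarkovKernel_sq : IsMarkovKernel (q ^ 2 : Kernel Ω Ω) := by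
  rw [pow_two]
  exact inferInstanceAs (IsMarkovKernel (q ∘ₖ q))

end Edge

/-! ### Flows out of sets -/

section Flow

variable {Ω : Type*} [MeasurableSpace Ω] {π : Measure Ω} {q : Kernel Ω Ω}

lemma flow_nonneg (n : ℕ) (A : Set Ω) : 0 ≤ flow q π n A := by
  rw [flow]
  exact mul_nonneg (by positivity) (integral_nonneg fun _ => measureReal_nonneg)

lemma bddBelow_flow (n : ℕ) : BddBelow (flow q π n '' properSets π) :=
  ⟨0, by rintro _ ⟨A, -, rfl⟩; exact flow_nonneg n A⟩

lemma isoConst_nonneg (n : ℕ) : 0 ≤ isoConst q π n :=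
  Real.sInf_nonneg (by rintro _ ⟨A, -, rfl⟩; exact flow_nonneg n A)

lemma isoConst_le_flow (n : ℕ) {A : Set Ω} (hA : A ∈ properSets π) :
    isoConst q π n ≤ flow q π n A :=
  csInf_le (bddBelow_flow n) ⟨A, hA, rfl⟩

variable [IsProbabilityMeasure π]

lemma real_pos_of_mem_properSets {A : Set Ω} (hA : A ∈ properSets π) :
    0 < π.real A ∧ 0 < π.real Aᶜ ∧ π.real A + π.real Aᶜ = 1 := by
  obtain ⟨hm, h0, h1⟩ := hA
  have h0' : 0 < π.real A := ENNReal.toReal_pos h0.ne' (measure_ne_top _ _)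
  have h1' : π.real A < 1 := by
    rw [measureReal_def, ← ENNReal.toReal_one]
    exact (ENNReal.toReal_lt_toReal (measure_ne_top _ _) ENNReal.one_ne_top).2 h1
  have := probReal_add_probReal_compl (μ := π) hm
  exact ⟨h0', by linarith, this⟩

lemma mem_properSets_of_real {A : Set Ω} (hm : MeasurableSet A) (h0 : 0 < π.real A)
    (h1 : 0 < π.real Aᶜ) : A ∈ properSets π := by
  have := probReal_add_probReal_compl (μ := π) hm
  refine ⟨hm, (ENNReal.toReal_pos_iff.1 h0).1, ?_⟩
  rw [← ENNReal.toReal_lt_toReal (measure_ne_top _ _) ENNReal.one_ne_top, ENNReal.toReal_one]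
  change π.real A < 1
  linarith

lemma flow_mul {n : ℕ} [IsMarkovKernel (q ^ n : Kernel Ω Ω)] {A : Set Ω}
    (hA : A ∈ properSets π) :
    flow q π n A * (π.real A * π.real Aᶜ) = (π ⊗ₘ (q ^ n : Kernel Ω Ω)).real (A ×ˢ Aᶜ) := by
  obtain ⟨h0, h1, -⟩ := real_pos_of_mem_properSets hA
  rw [flow, setIntegral_kernel_real hA.1 hA.1.compl]
  field_simp

/-- The defining inequality of `kₙ`, valid for all measurable sets. -/
lemma isoConst_mul_le (n : ℕ) [IsMarkovKernel (q ^ n : Kernel Ω Ω)] {A : Set Ω}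
    (hA : MeasurableSet A) :
    isoConst q π n * (π.real A * π.real Aᶜ) ≤ (π ⊗ₘ (q ^ n : Kernel Ω Ω)).real (A ×ˢ Aᶜ) := by
  by_cases h : 0 < π.real A ∧ 0 < π.real Aᶜ
  · have hp := mem_properSets_of_real hA h.1 h.2
    rw [← flow_mul hp]
    exact mul_le_mul_of_nonneg_right (isoConst_le_flow n hp) (by positivity)
  · have : π.real A * π.real Aᶜ = 0 := by
      rw [not_and_or, not_lt, not_lt] at h
      rcases h with h | h
      · rw [le_antisymm h measureReal_nonneg, zero_mul]
      · rw [le_antisymm h measureReal_nonneg, mul_zero]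
    rw [this, mul_zero]
    exact measureReal_nonneg

/-- By symmetry the edge mass is at most both `π(A)` and `π(Aᶜ)`; dividing, the flow times either of
them is at most 1, and the two add up to 1. -/
lemma flow_le_two {n : ℕ} [IsMarkovKernel (q ^ n : Kernel Ω Ω)]
    (h : (q ^ n : Kernel Ω Ω).IsReversible π) {A : Set Ω} (hA : A ∈ properSets π) :
    flow q π n A ≤ 2 := by
  obtain ⟨h0, h1, hs⟩ := real_pos_of_mem_properSets hA
  have ha : (π ⊗ₘ (q ^ n : Kernel Ω Ω)).real (A ×ˢ Aᶜ) ≤ π.real A := by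
    rw [← edge_real_prod_univ (q := (q ^ n : Kernel Ω Ω)) hA.1]
    exact measureReal_mono (Set.prod_mono le_rfl (Set.subset_univ _))
  have hb : (π ⊗ₘ (q ^ n : Kernel Ω Ω)).real (A ×ˢ Aᶜ) ≤ π.real Aᶜ := by
    rw [edge_real_prod_comm h hA.1 hA.1.compl,
      ← edge_real_prod_univ (q := (q ^ n : Kernel Ω Ω)) hA.1.compl]
    exact measureReal_mono (Set.prod_mono le_rfl (Set.subset_univ _))
  rw [← flow_mul hA] at ha hb
  have ha' : flow q π n A * π.real Aᶜ ≤ 1 := by nlinarith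
  have hb' : flow q π n A * π.real A ≤ 1 := by nlinarith
  nlinarith

end Flow

section Coarea

variable {Ω : Type*} [MeasurableSpace Ω]

/-! ### A Cheeger inequality for the edge measure -/

/-- The layer-cake formula for `|u(x) - u(y)|`. -/
lemma lintegral_abs_sub_eq (μ : Measure (Ω × Ω)) [SFinite μ] {u : Ω → ℝ} (hu : Measurable u) :
    ∫⁻ z, ENNReal.ofReal |u z.1 - u z.2| ∂μ =
      ∫⁻ t, (μ ({x | t < u x} ×ˢ {x | t < u x}ᶜ) + μ ({x | t < u x}ᶜ ×ˢ {x | t < u x})) := by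
  -- Triples whose level `t` separates the endpoints: the slice over an edge is an interval of
  -- length `|u z.1 - u z.2|`, the slice at level `t` consists of the edges crossing `{t < u}`.
  -- Fubini compares the two.
  set S : Set ((Ω × Ω) × ℝ) :=
    {w | w.2 < u w.1.1 ∧ u w.1.2 ≤ w.2} ∪ {w | w.2 < u w.1.2 ∧ u w.1.1 ≤ w.2} with hS
  have hSm : MeasurableSet S := by
    have h1 : Measurable fun w : (Ω × Ω) × ℝ => u w.1.1 := by fun_prop
    have h2 : Measurable fun w : (Ω × Ω) × ℝ => u w.1.2 := by fun_prop
    exact ((measurableSet_lt measurable_snd h1).inter (measurableSet_le h2 measurable_snd)).union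
      ((measurableSet_lt measurable_snd h2).inter (measurableSet_le h1 measurable_snd))
  have e1 : (μ.prod volume) S = ∫⁻ z, ENNReal.ofReal |u z.1 - u z.2| ∂μ := by
    rw [Measure.prod_apply hSm]
    refine lintegral_congr fun z => ?_
    have : Prod.mk z ⁻¹' S = Set.Ico (u z.2) (u z.1) ∪ Set.Ico (u z.1) (u z.2) := by
      ext t
      simp [hS, and_comm]
    rw [this]
    rcases le_total (u z.1) (u z.2) with h | h
    · rw [Set.Ico_eq_empty (not_lt.2 h), Set.empty_union, Real.volume_Ico, abs_sub_comm,
        abs_of_nonneg (sub_nonneg.2 h)]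
    · rw [Set.Ico_eq_empty (a := u z.1) (not_lt.2 h), Set.union_empty, Real.volume_Ico,
        abs_of_nonneg (sub_nonneg.2 h)]
  rw [← e1, Measure.prod_apply_symm hSm]
  refine lintegral_congr fun t => ?_
  have hA : MeasurableSet {x | t < u x} := measurableSet_lt measurable_const hu
  rw [← measure_union _ (hA.compl.prod hA)]
  · congr 1
    ext z
    simp [hS, and_comm]
  · rw [Set.disjoint_left]
    rintro z ⟨h1, -⟩ ⟨h2, -⟩
    exact h2 h1

lemma sq_integral_abs_mul_le {α : Type*} [MeasurableSpace α] {μ : Measure α} {f g : α → ℝ}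
    (hf : MemLp f 2 μ) (hg : MemLp g 2 μ) :
    (∫ x, |f x * g x| ∂μ) ^ 2 ≤ (∫ x, f x ^ 2 ∂μ) * ∫ x, g x ^ 2 ∂μ := by
  have h := integral_mul_norm_le_Lp_mul_Lq Real.HolderConjugate.two_two
    (f := f) (g := g) (μ := μ) (by simpa using hf) (by simpa using hg)
  simp only [Real.norm_eq_abs, Real.rpow_two, sq_abs, ← Real.sqrt_eq_rpow, ← abs_mul] at h
  calc _ ≤ (√(∫ x, f x ^ 2 ∂μ) * √(∫ x, g x ^ 2 ∂μ)) ^ 2 :=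
        pow_le_pow_left₀ (integral_nonneg fun _ => abs_nonneg _) h 2
    _ = _ := by
        rw [mul_pow, Real.sq_sqrt (integral_nonneg fun _ => sq_nonneg _),
          Real.sq_sqrt (integral_nonneg fun _ => sq_nonneg _)]

lemma integral_comp_measurePreserving {α β E : Type*} [MeasurableSpace α] [MeasurableSpace β]
    [NormedAddCommGroup E] [NormedSpace ℝ E] {μ : Measure α} {ν : Measure β} {φ : α → β}
    (hφ : MeasurePreserving φ μ ν) {g : β → E} (hg : AEStronglyMeasurable g ν) :
    ∫ x, g (φ x) ∂μ = ∫ y, g y ∂ν := by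
  rw [← hφ.map_eq] at hg ⊢
  exact (integral_map hφ.measurable.aemeasurable hg).symm

variable {π : Measure Ω} [IsProbabilityMeasure π] {q : Kernel Ω Ω} [IsMarkovKernel q]

/-- The isoperimetric bound is integrated over all superlevel sets of `u`, with independent pairs as
the reference measure. -/
lemma integral_abs_sub_le (h : q.IsReversible π) {k : ℝ} (hk0 : 0 ≤ k)
    (hk : ∀ A, MeasurableSet A → k * (π.real A * π.real Aᶜ) ≤ (π ⊗ₘ q).real (A ×ˢ Aᶜ))
    {u : Ω → ℝ} (hu : Measurable u) (hi : Integrable u π) :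
    k * ∫ z, |u z.1 - u z.2| ∂(π.prod π) ≤ ∫ z, |u z.1 - u z.2| ∂(π ⊗ₘ q) := by
  have hJ : Integrable (fun z : Ω × Ω => |u z.1 - u z.2|) (π ⊗ₘ q) :=
    ((edge_measurePreserving_fst.integrable_comp_of_integrable hi).sub
      ((edge_measurePreserving_snd h).integrable_comp_of_integrable hi)).abs
  have hP : Integrable (fun z : Ω × Ω => |u z.1 - u z.2|) (π.prod π) :=
    ((measurePreserving_fst.integrable_comp_of_integrable hi).sub
      (measurePreserving_snd.integrable_comp_of_integrable hi)).abs
  have key (A : Set Ω) (hA : MeasurableSet A) :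
      ENNReal.ofReal k * (π.prod π) (A ×ˢ Aᶜ) ≤ (π ⊗ₘ q) (A ×ˢ Aᶜ) := by
    rw [Measure.prod_prod, ← ofReal_measureReal, ← ofReal_measureReal (s := Aᶜ),
      ← ofReal_measureReal (s := A ×ˢ Aᶜ), ← ENNReal.ofReal_mul measureReal_nonneg,
      ← ENNReal.ofReal_mul hk0]
    exact ENNReal.ofReal_le_ofReal (hk A hA)
  have hl : ENNReal.ofReal k * ∫⁻ z, ENNReal.ofReal |u z.1 - u z.2| ∂(π.prod π)
      ≤ ∫⁻ z, ENNReal.ofReal |u z.1 - u z.2| ∂(π ⊗ₘ q) := by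
    rw [lintegral_abs_sub_eq _ hu, lintegral_abs_sub_eq _ hu,
      ← lintegral_const_mul' _ _ ENNReal.ofReal_ne_top]
    refine lintegral_mono fun t => ?_
    have hA : MeasurableSet {x | t < u x} := measurableSet_lt measurable_const hu
    rw [mul_add]
    have h2 := key _ hA.compl
    rw [compl_compl] at h2
    exact add_le_add (key _ hA) h2
  rw [← ofReal_integral_eq_lintegral_ofReal hP (ae_of_all _ fun _ => abs_nonneg _),
    ← ofReal_integral_eq_lintegral_ofReal hJ (ae_of_all _ fun _ => abs_nonneg _),
    ← ENNReal.ofReal_mul hk0] at hl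
  exact (ENNReal.ofReal_le_ofReal_iff (integral_nonneg fun _ => abs_nonneg _)).1 hl

/-- Cheeger's inequality for the Dirichlet form, with a constant better than the classical one. -/
theorem cheeger_real (h : q.IsReversible π) {k : ℝ} (hk0 : 0 ≤ k)
    (hk : ∀ A, MeasurableSet A → k * (π.real A * π.real Aᶜ) ≤ (π ⊗ₘ q).real (A ×ˢ Aᶜ))
    {u : Ω → ℝ} (hu : Measurable u) (hL : MemLp u 2 π) (h0 : ∫ x, u x ∂π = 0) :
    9 / 25 * k ^ 2 * ∫ x, u x ^ 2 ∂π ≤ ∫ z, (u z.1 - u z.2) ^ 2 ∂(π ⊗ₘ q) := by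
  have hi : Integrable u π := hL.integrable (by norm_num)
  have hi2 : Integrable (fun x => u x ^ 2) π := hL.integrable_sq
  have L1 : MemLp (fun z : Ω × Ω => u z.1) 2 (π ⊗ₘ q) :=
    hL.comp_measurePreserving edge_measurePreserving_fst
  have L2 : MemLp (fun z : Ω × Ω => u z.2) 2 (π ⊗ₘ q) :=
    hL.comp_measurePreserving (edge_measurePreserving_snd h)
  have Lsub : MemLp (fun z : Ω × Ω => u z.1 - u z.2) 2 (π ⊗ₘ q) := L1.sub L2
  have Ladd : MemLp (fun z : Ω × Ω => u z.1 + u z.2) 2 (π ⊗ₘ q) := L1.add L2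
  set V := ∫ x, u x ^ 2 ∂π with hV
  set D := ∫ z, (u z.1 - u z.2) ^ 2 ∂(π ⊗ₘ q) with hD
  have hV0 : 0 ≤ V := integral_nonneg fun _ => sq_nonneg _
  have hD0 : 0 ≤ D := integral_nonneg fun _ => sq_nonneg _
  set a := ∫ z, |u z.1 - u z.2| ∂(π.prod π) with ha
  have ha0 : 0 ≤ a := integral_nonneg fun _ => abs_nonneg _
  have hkD : k ^ 2 * a ^ 2 ≤ D := by
    have h1 := integral_abs_sub_le h hk0 hk hu hi
    have h2 := sq_integral_abs_mul_le Lsub (memLp_const (1 : ℝ))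
    simp only [mul_one, one_pow, integral_const, probReal_univ, smul_eq_mul] at h2
    rw [← mul_pow]
    exact (pow_le_pow_left₀ (by positivity) h1 2).trans h2
  -- The same argument for `u²`; Cauchy–Schwarz now splits `u(x)² - u(y)²` into difference times
  -- sum.
  set N := ∫ z, |u z.1 ^ 2 - u z.2 ^ 2| ∂(π.prod π) with hN
  have hN0 : 0 ≤ N := integral_nonneg fun _ => abs_nonneg _
  have hkN : k ^ 2 * N ^ 2 ≤ D * (4 * V) := by
    have h1 := integral_abs_sub_le h hk0 hk (hu.pow_const 2) hi2
    have h2 := sq_integral_abs_mul_le Lsub Ladd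
    have h3 : ∫ z, (u z.1 + u z.2) ^ 2 ∂(π ⊗ₘ q) ≤ 4 * V := by
      have I1 : ∫ z, u z.1 ^ 2 ∂(π ⊗ₘ q) = V :=
        integral_comp_measurePreserving edge_measurePreserving_fst hi2.aestronglyMeasurable
      have I2 : ∫ z, u z.2 ^ 2 ∂(π ⊗ₘ q) = V :=
        integral_comp_measurePreserving (edge_measurePreserving_snd h) hi2.aestronglyMeasurable
      calc ∫ z, (u z.1 + u z.2) ^ 2 ∂(π ⊗ₘ q)
          ≤ ∫ z, (2 * u z.1 ^ 2 + 2 * u z.2 ^ 2) ∂(π ⊗ₘ q) := by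
            refine integral_mono Ladd.integrable_sq
              ((L1.integrable_sq.const_mul 2).add (L2.integrable_sq.const_mul 2)) fun z => ?_
            change (u z.1 + u z.2) ^ 2 ≤ 2 * u z.1 ^ 2 + 2 * u z.2 ^ 2
            nlinarith [sq_nonneg (u z.1 - u z.2)]
        _ = 4 * V := by
            rw [integral_add (L1.integrable_sq.const_mul 2) (L2.integrable_sq.const_mul 2),
              integral_const_mul, integral_const_mul, I1, I2]
            ring
    have h4 : ∀ z : Ω × Ω, |(u z.1 - u z.2) * (u z.1 + u z.2)| = |u z.1 ^ 2 - u z.2 ^ 2| :=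
      fun z => by congr 1; ring
    simp only [h4] at h2
    rw [← mul_pow]
    exact (pow_le_pow_left₀ (by positivity) h1 2).trans
      (h2.trans (mul_le_mul_of_nonneg_left h3 hD0))
  have hP1 : MemLp (fun z : Ω × Ω => u z.1) 2 (π.prod π) :=
    hL.comp_measurePreserving measurePreserving_fst
  have hP2 : MemLp (fun z : Ω × Ω => u z.2) 2 (π.prod π) :=
    hL.comp_measurePreserving measurePreserving_snd
  set b := ∫ x, |u x| ∂π with hb
  have hb0 : 0 ≤ b := integral_nonneg fun _ => abs_nonneg _
  have hba : b ≤ a := by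
    have hint : Integrable (fun z : Ω × Ω => |u z.1 - u z.2|) (π.prod π) :=
      ((hP1.integrable (by norm_num)).sub (hP2.integrable (by norm_num))).abs
    rw [ha, integral_prod _ hint]
    refine integral_mono hi.abs hint.integral_prod_left fun x => ?_
    -- Mean zero allows an independent copy to be subtracted.
    calc |u x| = |∫ y, (u x - u y) ∂π| := by
          rw [integral_sub (integrable_const _) hi, h0]; simp
      _ ≤ ∫ y, |u x - u y| ∂π := abs_integral_le_integral_abs
  have hNb : 2 * V - 2 * b ^ 2 ≤ N := by
    have i1 : Integrable (fun z : Ω × Ω => u z.1 ^ 2) (π.prod π) := hP1.integrable_sq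
    have i2 : Integrable (fun z : Ω × Ω => u z.2 ^ 2) (π.prod π) := hP2.integrable_sq
    have i3 : Integrable (fun z : Ω × Ω => |u z.1| * |u z.2|) (π.prod π) :=
      hi.abs.mul_prod hi.abs
    have i12 : Integrable (fun z : Ω × Ω => u z.1 ^ 2 + u z.2 ^ 2) (π.prod π) := i1.add i2
    have e : ∫ z : Ω × Ω, (u z.1 ^ 2 + u z.2 ^ 2 - 2 * (|u z.1| * |u z.2|)) ∂(π.prod π)
        = 2 * V - 2 * b ^ 2 := by
      rw [integral_sub i12 (i3.const_mul 2), integral_add i1 i2, integral_const_mul,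
        integral_prod_mul (fun x => |u x|) (fun x => |u x|),
        integral_fun_fst (fun x => u x ^ 2), integral_fun_snd (fun x => u x ^ 2)]
      simp only [probReal_univ, one_smul]
      ring
    rw [← e]
    refine integral_mono (i12.sub (i3.const_mul 2)) (i1.sub i2).abs fun z => ?_
    change u z.1 ^ 2 + u z.2 ^ 2 - 2 * (|u z.1| * |u z.2|) ≤ |u z.1 ^ 2 - u z.2 ^ 2|
    rw [← sq_abs (u z.1), ← sq_abs (u z.2)]
    have hx := abs_nonneg (u z.1)
    have hy := abs_nonneg (u z.2)
    rcases le_total |u z.1| |u z.2| with hxy | hxy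
    · refine le_trans ?_ (neg_le_abs _)
      nlinarith
    · refine le_trans ?_ (le_abs_self _)
      nlinarith
  -- If `a²` is large, the bound from `u` suffices. Otherwise `b² ≤ a²` is small, so `N ≥ (2 -
  -- 18/25) V = 32/25 V`, and the bound from `u²` gives the constant `(32/25)²/4 = 256/625`, which
  -- exceeds `9/25`.
  rcases le_total (9 / 25 * V) (a ^ 2) with hc | hc
  · nlinarith [mul_le_mul_of_nonneg_left hc (sq_nonneg k)]
  · have hN' : 32 / 25 * V ≤ N := by nlinarith
    rcases hV0.eq_or_lt with hV' | hV'
    · rw [← hV', mul_zero]; exact hD0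
    · have h5 : k ^ 2 * (32 / 25 * V) ^ 2 ≤ D * (4 * V) :=
        (mul_le_mul_of_nonneg_left (pow_le_pow_left₀ (by positivity) hN' 2)
          (sq_nonneg k)).trans hkN
      have h6 : (k ^ 2 * (256 / 625) * V) * (4 * V) ≤ D * (4 * V) := by linarith
      have h7 := le_of_mul_le_mul_right h6 (by positivity)
      nlinarith [mul_nonneg (sq_nonneg k) hV0]

end Coarea

section MarkovOperator

variable {𝕜 : Type*} [RCLike 𝕜] {Ω : Type*} [MeasurableSpace Ω] {π : Measure Ω}

lemma integral_norm_sq_eq (f : Lp 𝕜 2 π) : ∫ x, ‖f x‖ ^ 2 ∂π = ‖f‖ ^ 2 := by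
  rw [← inner_self_eq_norm_sq (𝕜 := 𝕜), L2.inner_def, ← integral_re (L2.integrable_inner f f)]
  simp only [inner_self_eq_norm_sq]

lemma integrable_norm_sq (f : Lp 𝕜 2 π) : Integrable (fun x => ‖f x‖ ^ 2) π :=
  (memLp_two_iff_integrable_sq_norm (Lp.memLp f).1).1 (Lp.memLp f)

variable [IsProbabilityMeasure π] {q : Kernel Ω Ω} [IsMarkovKernel q]

/-! ### The Markov operator and its Dirichlet form -/

lemma integrable_inner_edge (h : q.IsReversible π) (f g : Lp 𝕜 2 π) :
    Integrable (fun z : Ω × Ω => inner 𝕜 (f z.1) (g z.2)) (π ⊗ₘ q) := by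
  have h1 : MemLp (fun z : Ω × Ω => f z.1) 2 (π ⊗ₘ q) :=
    (Lp.memLp f).comp_measurePreserving edge_measurePreserving_fst
  have h2 : MemLp (fun z : Ω × Ω => g z.2) 2 (π ⊗ₘ q) :=
    (Lp.memLp g).comp_measurePreserving (edge_measurePreserving_snd h)
  refine (L2.integrable_inner (𝕜 := 𝕜) h1.toLp h2.toLp).congr ?_
  filter_upwards [h1.coeFn_toLp, h2.coeFn_toLp] with z e1 e2
  rw [e1, e2]

lemma inner_markovOp_right (h : q.IsReversible π) (f g : Lp 𝕜 2 π) :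
    inner 𝕜 f (markovOp 𝕜 h.invariant g) = ∫ z, inner 𝕜 (f z.1) (g z.2) ∂(π ⊗ₘ q) := by
  rw [L2.inner_def, Measure.integral_compProd (integrable_inner_edge h f g)]
  refine integral_congr_ae ?_
  filter_upwards [markovOp_coeFn h.invariant g, ae_integrable_kernel h.invariant g] with x hx hg
  rw [hx, integral_inner hg]

lemma inner_markovOp_left (h : q.IsReversible π) (f g : Lp 𝕜 2 π) :
    inner 𝕜 (markovOp 𝕜 h.invariant f) g = inner 𝕜 f (markovOp 𝕜 h.invariant g) := by
  rw [← inner_conj_symm, inner_markovOp_right h, inner_markovOp_right h, ← integral_conj,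
    ← integral_comp_measurePreserving (edge_measurePreserving_swap h)
      (integrable_inner_edge h f g).aestronglyMeasurable]
  simp only [inner_conj_symm, Prod.fst_swap, Prod.snd_swap]

lemma dirichlet_form_eq (h : q.IsReversible π) (f : Lp 𝕜 2 π) :
    ∫ z, ‖f z.1 - f z.2‖ ^ 2 ∂(π ⊗ₘ q)
      = 2 * ‖f‖ ^ 2 - 2 * RCLike.re (inner 𝕜 f (markovOp 𝕜 h.invariant f)) := by
  have hf := integrable_norm_sq f
  have i1 : Integrable (fun z : Ω × Ω => ‖f z.1‖ ^ 2) (π ⊗ₘ q) :=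
    edge_measurePreserving_fst.integrable_comp_of_integrable hf
  have i2 : Integrable (fun z : Ω × Ω => ‖f z.2‖ ^ 2) (π ⊗ₘ q) :=
    (edge_measurePreserving_snd h).integrable_comp_of_integrable hf
  have i3 := (integrable_inner_edge h f f).re
  have i13 : Integrable (fun z : Ω × Ω => ‖f z.1‖ ^ 2 - 2 * RCLike.re (inner 𝕜 (f z.1) (f z.2)))
    (π ⊗ₘ q) := i1.sub (i3.const_mul 2)
  simp_rw [fun x y : 𝕜 => norm_sub_sq (𝕜 := 𝕜) x y]
  rw [integral_add i13 i2, integral_sub i1 (i3.const_mul 2), integral_const_mul, integral_re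
    (integrable_inner_edge h f f), ← inner_markovOp_right h,
    integral_comp_measurePreserving edge_measurePreserving_fst hf.aestronglyMeasurable,
    integral_comp_measurePreserving (edge_measurePreserving_snd h) hf.aestronglyMeasurable,
    integral_norm_sq_eq]
  ring

/-- Real and imaginary parts are treated separately. The constant `36/25/8` is half of `9/25`,
because the edge integral is twice `⟨f, (1 - P)f⟩`. -/
lemma cheeger_L2Zero (h : q.IsReversible π) {k : ℝ} (hk0 : 0 ≤ k)
    (hk : ∀ A, MeasurableSet A → k * (π.real A * π.real Aᶜ) ≤ (π ⊗ₘ q).real (A ×ˢ Aᶜ))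
    {f : Lp 𝕜 2 π} (hf : f ∈ L2Zero 𝕜 π) :
    RCLike.re (inner 𝕜 f (markovOp 𝕜 h.invariant f)) ≤ (1 - 36 / 25 / 8 * k ^ 2) * ‖f‖ ^ 2 := by
  have hm : Measurable f := (Lp.stronglyMeasurable f).measurable
  have hL := Lp.memLp f
  have hi : Integrable f π := hL.integrable (by norm_num)
  have hf0 : ∫ x, f x ∂π = 0 := hf
  have d1 := cheeger_real h hk0 hk (RCLike.measurable_re.comp hm) hL.re
    (by
    have := integral_re hi
    rw [hf0, map_zero] at this
    exact this)
  have d2 := cheeger_real h hk0 hk (RCLike.measurable_im.comp hm) hL.im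
    (by
    have := integral_im hi
    rw [hf0, map_zero] at this
    exact this)
  have hsub : MemLp (fun z : Ω × Ω => f z.1 - f z.2) 2 (π ⊗ₘ q) :=
    (hL.comp_measurePreserving edge_measurePreserving_fst).sub
      (hL.comp_measurePreserving (edge_measurePreserving_snd h))
  have hn (z : 𝕜) : ‖z‖ ^ 2 = RCLike.re z ^ 2 + RCLike.im z ^ 2 := by
    rw [← RCLike.normSq_eq_def', RCLike.normSq_apply]; ring
  have e1 : ∫ x, ‖f x‖ ^ 2 ∂π = ∫ x, RCLike.re (f x) ^ 2 ∂π + ∫ x, RCLike.im (f x) ^ 2 ∂π := by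
    simp_rw [hn]
    exact integral_add hL.re.integrable_sq hL.im.integrable_sq
  have e2 : ∫ z, ‖f z.1 - f z.2‖ ^ 2 ∂(π ⊗ₘ q)
      = ∫ z, (RCLike.re (f z.1) - RCLike.re (f z.2)) ^ 2 ∂(π ⊗ₘ q)
        + ∫ z, (RCLike.im (f z.1) - RCLike.im (f z.2)) ^ 2 ∂(π ⊗ₘ q) := by
    simp_rw [hn, ← map_sub]
    exact integral_add hsub.re.integrable_sq hsub.im.integrable_sq
  rw [integral_norm_sq_eq] at e1
  rw [dirichlet_form_eq h] at e2
  simp only [Function.comp_apply] at d1 d2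
  nlinarith

lemma markovOp_sq (h : q.IsReversible π) (f : Lp 𝕜 2 π) :
    markovOp 𝕜 (isReversible_sq h).invariant f
      = markovOp 𝕜 h.invariant (markovOp 𝕜 h.invariant f) := by
  refine Lp.ext ?_
  filter_upwards [markovOp_coeFn (isReversible_sq h).invariant f,
    ae_integrable_kernel (isReversible_sq h).invariant f,
    markovOp_coeFn h.invariant (markovOp 𝕜 h.invariant f),
    ae_kernel h.invariant (markovOp_coeFn h.invariant f)] with x h1 h2 h3 h4
  rw [h1, h3, integral_congr_ae h4]
  have e : (q ^ 2 : Kernel Ω Ω) = q ∘ₖ q := pow_two q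
  rw [e] at h2 ⊢
  exact Kernel.integral_comp h2

lemma re_inner_markovOp_sq (h : q.IsReversible π) (f : Lp 𝕜 2 π) :
    RCLike.re (inner 𝕜 f (markovOp 𝕜 (isReversible_sq h).invariant f))
      = ‖markovOp 𝕜 h.invariant f‖ ^ 2 := by
  rw [markovOp_sq h, ← inner_markovOp_left h, inner_self_eq_norm_sq]

/-- As the orthogonal complement of the constants, this subspace is closed, hence complete, as the
spectral criterion requires. -/
lemma isClosed_L2Zero : IsClosed (L2Zero 𝕜 π : Set (Lp 𝕜 2 π)) := by
  have : (L2Zero 𝕜 π : Set (Lp 𝕜 2 π)) = {f | inner 𝕜 (indicatorConstLp 2 MeasurableSet.univ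
      (measure_ne_top π Set.univ) (1 : 𝕜)) f = 0} := by
    ext f
    rw [Set.mem_ofPred_eq, L2.inner_indicatorConstLp_one, setIntegral_univ]
    rfl
  rw [this]
  exact isClosed_eq (by fun_prop) continuous_const

instance completeSpace_L2Zero : CompleteSpace (L2Zero 𝕜 π) :=
  isClosed_L2Zero.completeSpace_coe

/-- The spectrum of a symmetric operator lies in every interval containing its numerical range. -/
lemma spectrum_subset_of_numerical_range {E : Type*} [NormedAddCommGroup E]
    [InnerProductSpace 𝕜 E] [CompleteSpace E] {T : E →L[𝕜] E}
    (hT : ∀ x y, inner 𝕜 (T x) y = inner 𝕜 x (T y)) {a b : ℝ}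
    (ha : ∀ x, a * ‖x‖ ^ 2 ≤ RCLike.re (inner 𝕜 x (T x)))
    (hb : ∀ x, RCLike.re (inner 𝕜 x (T x)) ≤ b * ‖x‖ ^ 2) :
    spectrum 𝕜 T ⊆ (fun t : ℝ => (t : 𝕜)) '' Set.Icc a b := by
  intro z hz
  by_contra hcon
  refine hz ?_
  -- `⟨x, Tx⟩` is real, so `z` keeps a positive distance from the numerical range, through its real
  -- part if `z` is real and through its imaginary part otherwise. Such a lower bound on the
  -- quadratic form of `z - T` makes it invertible.
  have key : ∃ c : ℝ, 0 < c ∧ ∀ x, c * ‖x‖ ^ 2 ≤ ‖z * ((‖x‖ ^ 2 : ℝ) : 𝕜) - inner 𝕜 x (T x)‖ := by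
    have him (x : E) : RCLike.im (inner 𝕜 x (T x)) = 0 := by
      rw [← RCLike.conj_eq_iff_im, inner_conj_symm, hT]
    by_cases hzi : RCLike.im z = 0
    · have hzr : z = (RCLike.re z : 𝕜) := (RCLike.conj_eq_iff_re.1 (RCLike.conj_eq_iff_im.2 hzi)).symm
      have hre : RCLike.re z < a ∨ b < RCLike.re z := by
        by_contra! h
        exact hcon ⟨RCLike.re z, ⟨h.1, h.2⟩, hzr.symm⟩
      have hr (x : E) : RCLike.re (z * ((‖x‖ ^ 2 : ℝ) : 𝕜) - inner 𝕜 x (T x))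
          = RCLike.re z * ‖x‖ ^ 2 - RCLike.re (inner 𝕜 x (T x)) := by
        rw [map_sub, RCLike.re_mul_ofReal]
      rcases hre with h | h
      · refine ⟨a - RCLike.re z, sub_pos.2 h, fun x => ?_⟩
        refine le_trans ?_ (RCLike.abs_re_le_norm _)
        rw [hr]
        refine le_trans ?_ (neg_le_abs _)
        linarith [ha x]
      · refine ⟨RCLike.re z - b, sub_pos.2 h, fun x => ?_⟩
        refine le_trans ?_ (RCLike.abs_re_le_norm _)
        rw [hr]
        refine le_trans ?_ (le_abs_self _)
        linarith [hb x]
    · refine ⟨|RCLike.im z|, abs_pos.2 hzi, fun x => ?_⟩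
      refine le_trans ?_ (RCLike.abs_im_le_norm _)
      rw [map_sub, him, sub_zero, RCLike.im_mul_ofReal, abs_mul, abs_of_nonneg (sq_nonneg ‖x‖)]
  obtain ⟨c, hc, hcx⟩ := key
  refine ContinuousLinearMap.isUnit_of_forall_le_norm_inner_map _ (c := ⟨c, hc.le⟩) hc fun x => ?_
  rw [mul_comm]
  refine (hcx x).trans (le_of_eq ?_)
  rw [← norm_inner_symm, sub_apply, inner_sub_right,
    Algebra.algebraMap_eq_smul_one, smul_apply,
    one_apply_eq_self, inner_smul_right, inner_self_eq_norm_sq_to_K]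
  simp

end MarkovOperator

section PowerGrowth

variable {𝕜 : Type*} [RCLike 𝕜] {E : Type*} [NormedAddCommGroup E] [InnerProductSpace 𝕜 E]

/-! ### Growth of the powers of a symmetric operator -/

lemma norm_pow_succ_sq_le {T : E →L[𝕜] E} (hT : ∀ x y, inner 𝕜 (T x) y = inner 𝕜 x (T y))
    (x : E) (n : ℕ) :
    ‖(T ^ (n + 1)) x‖ ^ 2 ≤ ‖(T ^ n) x‖ * ‖(T ^ (n + 2)) x‖ := by
  have h1 : (T ^ (n + 1)) x = T ((T ^ n) x) := by rw [pow_succ']; rfl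
  have h2 : (T ^ (n + 2)) x = T (T ((T ^ n) x)) := by rw [pow_succ', pow_succ']; rfl
  rw [h1, h2, ← inner_self_eq_norm_sq (𝕜 := 𝕜), hT]
  exact (RCLike.re_le_norm _).trans (norm_inner_le_norm _ _)

/-- Log-convexity makes the ratios `‖Tⁿ⁺¹x‖ / ‖Tⁿx‖` increase to a limit, which is at least the
first ratio `‖Tx‖`; the `n`-th root is the geometric mean of these ratios and has the same limit. -/
lemma exists_tendsto_norm_pow_rpow {T : E →L[𝕜] E}
    (hT : ∀ x y, inner 𝕜 (T x) y = inner 𝕜 x (T y)) {x : E} (hx : ‖x‖ = 1) :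
    ∃ l : ℝ, Tendsto (fun n : ℕ => ‖(T ^ n) x‖ ^ (1 / (n : ℝ))) atTop (𝓝 l) ∧ ‖T x‖ ≤ l := by
  set b : ℕ → ℝ := fun n => ‖(T ^ n) x‖ with hb
  have b0 : b 0 = 1 := by simp [hb, hx]
  have b1 : b 1 = ‖T x‖ := by simp [hb]
  have hnn (n : ℕ) : 0 ≤ b n := norm_nonneg _
  have hcv (n : ℕ) : b (n + 1) ^ 2 ≤ b n * b (n + 2) := norm_pow_succ_sq_le hT x n
  have hsucc (n : ℕ) : b (n + 1) ≤ ‖T‖ * b n := by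
    have h1 : (T ^ (n + 1)) x = T ((T ^ n) x) := by rw [pow_succ']; rfl
    simp only [hb, h1]
    exact T.le_opNorm _
  -- Without this case the ratios may be undefined. By log-convexity a zero propagates down to `b
  -- 1`, and then all later terms vanish.
  by_cases hz : ∃ m, b m = 0
  · have hz1 : b 1 = 0 := by
      obtain ⟨m, hm⟩ := hz
      induction m with
      | zero => rw [b0] at hm; exact absurd hm one_ne_zero
      | succ m ih =>
        rcases m with _ | m
        · exact hm
        · refine ih (pow_eq_zero_iff two_ne_zero |>.1 (le_antisymm ?_ (sq_nonneg _)))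
          have := hcv m
          rwa [hm, mul_zero] at this
    have hz' (n : ℕ) : b (n + 1) = 0 := by
      induction n with
      | zero => exact hz1
      | succ n ih => exact le_antisymm ((hsucc _).trans (by rw [ih, mul_zero])) (hnn _)
    refine ⟨0, ?_, by rw [← b1, hz1]⟩
    refine tendsto_const_nhds.congr' ?_
    filter_upwards [eventually_ge_atTop 1] with n hn
    obtain ⟨m, rfl⟩ := Nat.exists_eq_add_of_le' hn
    have : b (m + 1) ^ (1 / ((m + 1 : ℕ) : ℝ)) = 0 := by
      rw [hz' m, Real.zero_rpow (by positivity)]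
    exact this.symm
  · have hpos (n : ℕ) : 0 < b n := (hnn n).lt_of_ne fun h => hz ⟨n, h.symm⟩
    set r : ℕ → ℝ := fun n => b (n + 1) / b n with hr
    have hrpos (n : ℕ) : 0 < r n := div_pos (hpos _) (hpos _)
    have hmono : Monotone r := by
      refine monotone_nat_of_le_succ fun n => ?_
      simp only [hr]
      rw [div_le_div_iff₀ (hpos _) (hpos _)]
      nlinarith [hcv n]
    have hbdd : BddAbove (Set.range r) := by
      refine ⟨‖T‖, ?_⟩
      rintro _ ⟨n, rfl⟩
      exact (div_le_iff₀ (hpos n)).2 (hsucc n)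
    have hlim := tendsto_atTop_ciSup hmono hbdd
    set l := ⨆ n, r n with hl
    have hr0 : r 0 ≤ l := le_ciSup hbdd 0
    have hl0 : 0 < l := (hrpos 0).trans_le hr0
    refine ⟨l, ?_, by simpa [hr, b0, b1] using hr0⟩
    have hlog : Tendsto (fun n => Real.log (r n)) atTop (𝓝 (Real.log l)) :=
      (Real.continuousAt_log hl0.ne').tendsto.comp hlim
    have hsum (n : ℕ) : ∑ i ∈ Finset.range n, Real.log (r i) = Real.log (b n) := by
      have h1 (i : ℕ) : Real.log (r i) = Real.log (b (i + 1)) - Real.log (b i) :=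
        Real.log_div (hpos _).ne' (hpos _).ne'
      simp_rw [h1]
      rw [Finset.sum_range_sub (fun i => Real.log (b i)), b0, Real.log_one, sub_zero]
    have hces := (Real.continuous_exp.tendsto _).comp hlog.cesaro
    rw [Real.exp_log hl0] at hces
    refine hces.congr fun n => ?_
    simp only [Function.comp_apply, hsum]
    change _ = b n ^ (1 / (n : ℝ))
    rw [Real.rpow_def_of_pos (hpos n), mul_comm, one_div]

end PowerGrowth

section Gap

variable {𝕜 : Type*} [RCLike 𝕜] {Ω : Type*} [MeasurableSpace Ω] {π : Measure Ω}
  [IsProbabilityMeasure π] {q : Kernel Ω Ω} [IsMarkovKernel q]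

/-! ### The spectral gap and the flows out of sets -/

lemma hasSpectralGap_of_norm_le (h : q.IsReversible π) {s : ℝ} (hs : s < 1)
    (hP : ∀ f ∈ L2Zero 𝕜 π, ‖markovOp 𝕜 h.invariant f‖ ≤ s * ‖f‖) :
    HasSpectralGap 𝕜 h.invariant := by
  refine ⟨1 - s, sub_pos.2 hs, fun f hf hf1 => ?_⟩
  obtain ⟨l, hl, -⟩ := exists_tendsto_norm_pow_rpow (inner_markovOp_left h) hf1
  refine ⟨l, ?_, hl⟩
  rw [sub_sub_cancel]
  have hs0 : 0 ≤ s := by simpa [hf1] using (norm_nonneg _).trans (hP f hf)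
  have hn (n : ℕ) : (markovOp 𝕜 h.invariant ^ n) f ∈ L2Zero 𝕜 π ∧
      ‖(markovOp 𝕜 h.invariant ^ n) f‖ ≤ s ^ n := by
    induction n with
    | zero => exact ⟨by simpa using hf, by simp [hf1]⟩
    | succ n ih =>
      have h1 : (markovOp 𝕜 h.invariant ^ (n + 1)) f
          = markovOp 𝕜 h.invariant ((markovOp 𝕜 h.invariant ^ n) f) := by rw [pow_succ']; rfl
      rw [h1]
      refine ⟨markovOp_mem_L2Zero _ _ ih.1, (hP _ ih.1).trans ?_⟩
      rw [pow_succ']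
      exact mul_le_mul_of_nonneg_left ih.2 hs0
  refine le_of_tendsto hl ?_
  filter_upwards [eventually_ge_atTop 1] with n hn1
  calc _ ≤ (s ^ n) ^ (1 / (n : ℝ)) :=
        Real.rpow_le_rpow (norm_nonneg _) (hn n).2 (by positivity)
    _ = s := by rw [one_div, Real.pow_rpow_inv_natCast hs0 (by omega)]

lemma norm_le_of_hasSpectralGap (h : q.IsReversible π) (hgap : HasSpectralGap 𝕜 h.invariant) :
    ∃ r : ℝ, 0 < r ∧ ∀ f ∈ L2Zero 𝕜 π, ‖markovOp 𝕜 h.invariant f‖ ≤ (1 - r) * ‖f‖ := by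
  obtain ⟨r, hr, hgap⟩ := hgap
  refine ⟨r, hr, fun f hf => ?_⟩
  rcases eq_or_ne f 0 with rfl | hf0
  · simp
  have hn : ‖f‖ ≠ 0 := norm_ne_zero_iff.2 hf0
  set g : Lp 𝕜 2 π := ((‖f‖⁻¹ : ℝ) : 𝕜) • f with hg
  have hg1 : ‖g‖ = 1 := by
    rw [hg, norm_smul, RCLike.norm_ofReal, abs_of_nonneg (by positivity), inv_mul_cancel₀ hn]
  obtain ⟨l, hl, hl1⟩ := hgap g ((L2Zero 𝕜 π).smul_mem _ hf) hg1
  obtain ⟨l', hl', hle⟩ := exists_tendsto_norm_pow_rpow (inner_markovOp_left h) hg1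
  rw [tendsto_nhds_unique hl' hl1] at hle
  have := hle.trans hl
  rw [hg, map_smul, norm_smul, RCLike.norm_ofReal, abs_of_nonneg (by positivity),
    inv_mul_le_iff₀ (by positivity)] at this
  linarith

lemma memLp_centered_indicator {A : Set Ω} (hA : MeasurableSet A) :
    MemLp (fun x => A.indicator (fun _ => (1 : 𝕜)) x - (π.real A : 𝕜)) 2 π :=
  (memLp_indicator_const 2 hA 1 (Or.inr (measure_ne_top _ _))).sub (memLp_const _)

/-- The function `1_A - π(A)` as an element of `L²(π)`. -/
noncomputable def centeredIndicator (𝕜 : Type*) [RCLike 𝕜] (π : Measure Ω)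
    [IsProbabilityMeasure π] {A : Set Ω} (hA : MeasurableSet A) : Lp 𝕜 2 π :=
  (memLp_centered_indicator hA).toLp

lemma centeredIndicator_coeFn {A : Set Ω} (hA : MeasurableSet A) :
    centeredIndicator 𝕜 π hA =ᵐ[π] fun x => A.indicator (fun _ => (1 : 𝕜)) x - (π.real A : 𝕜) :=
  (memLp_centered_indicator hA).coeFn_toLp

lemma centeredIndicator_mem {A : Set Ω} (hA : MeasurableSet A) :
    centeredIndicator 𝕜 π hA ∈ L2Zero 𝕜 π := by
  change ∫ x, centeredIndicator 𝕜 π hA x ∂π = 0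
  rw [integral_congr_ae (centeredIndicator_coeFn hA), integral_sub
    ((integrable_const _).indicator hA) (integrable_const _), integral_indicator hA]
  simp [measureReal_def, Algebra.smul_def]

lemma norm_sq_centeredIndicator {A : Set Ω} (hA : MeasurableSet A) :
    ‖centeredIndicator 𝕜 π hA‖ ^ 2 = π.real A * π.real Aᶜ := by
  have hs := probReal_add_probReal_compl (μ := π) hA
  have e : (fun x => ‖centeredIndicator 𝕜 π hA x‖ ^ 2) =ᵐ[π]
      fun x => A.indicator (fun _ => π.real Aᶜ ^ 2) x + Aᶜ.indicator (fun _ => π.real A ^ 2) x := by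
    filter_upwards [centeredIndicator_coeFn (𝕜 := 𝕜) (π := π) hA] with x hx
    rw [hx]
    by_cases hxA : x ∈ A
    · have : (1 : 𝕜) - (π.real A : 𝕜) = ((π.real Aᶜ : ℝ) : 𝕜) := by
        rw [eq_sub_of_add_eq' hs]; simp
      simp [hxA, this]
    · simp [hxA]
  rw [← integral_norm_sq_eq, integral_congr_ae e, integral_add
    ((integrable_const _).indicator hA) ((integrable_const _).indicator hA.compl),
    integral_indicator_const _ hA, integral_indicator_const _ hA.compl, smul_eq_mul, smul_eq_mul]
  linear_combination (π.real A * π.real Aᶜ) * hs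

/-- The Dirichlet form of an indicator counts the crossing edges in both directions. -/
lemma re_inner_centeredIndicator (h : q.IsReversible π) {A : Set Ω} (hA : MeasurableSet A) :
    RCLike.re (inner 𝕜 (centeredIndicator 𝕜 π hA)
      (markovOp 𝕜 h.invariant (centeredIndicator 𝕜 π hA)))
      = π.real A * π.real Aᶜ - (π ⊗ₘ q).real (A ×ˢ Aᶜ) := by
  have h1 := dirichlet_form_eq h (centeredIndicator 𝕜 π hA)
  have hA2 := hA.prod hA.compl
  have hA3 := hA.compl.prod hA
  have e : (fun z : Ω × Ω => ‖centeredIndicator 𝕜 π hA z.1 - centeredIndicator 𝕜 π hA z.2‖ ^ 2)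
      =ᵐ[π ⊗ₘ q] fun z => (A ×ˢ Aᶜ).indicator (fun _ => (1 : ℝ)) z
        + (Aᶜ ×ˢ A).indicator (fun _ => (1 : ℝ)) z := by
    filter_upwards [edge_measurePreserving_fst.quasiMeasurePreserving.ae
        (centeredIndicator_coeFn (𝕜 := 𝕜) (π := π) hA),
      (edge_measurePreserving_snd h).quasiMeasurePreserving.ae
        (centeredIndicator_coeFn (𝕜 := 𝕜) (π := π) hA)] with z hz1 hz2
    rw [hz1, hz2, sub_sub_sub_cancel_right]
    by_cases hx : z.1 ∈ A <;> by_cases hy : z.2 ∈ A <;> simp [Set.indicator, hx, hy]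
  rw [integral_congr_ae e, integral_add ((integrable_const _).indicator hA2)
    ((integrable_const _).indicator hA3), integral_indicator_const _ hA2,
    integral_indicator_const _ hA3, edge_real_prod_comm h hA.compl hA,
    norm_sq_centeredIndicator] at h1
  simp only [smul_eq_mul, mul_one] at h1
  linarith

end Gap

/-! ### The lower bound for the two-step constant -/

section TwoStep

variable {Ω : Type*} [MeasurableSpace Ω] {π : Measure Ω} [IsProbabilityMeasure π]
  {q : Kernel Ω Ω} [IsMarkovKernel q]

lemma edge_sq_real_prod (h : q.IsReversible π) {A B : Set Ω} (hA : MeasurableSet A)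
    (hB : MeasurableSet B) :
    (π ⊗ₘ (q ^ 2 : Kernel Ω Ω)).real (A ×ˢ B) = ∫ x, (q x).real A * (q x).real B ∂π := by
  rw [measureReal_def, Measure.compProd_apply_prod hA hB, setLIntegral_sq_apply h hA hB]
  simp only [measureReal_def, ← ENNReal.toReal_mul]
  exact (integral_toReal ((q.measurable_coe hA).mul (q.measurable_coe hB)).aemeasurable
    (ae_of_all _ fun x => ENNReal.mul_lt_top (measure_lt_top _ _) (measure_lt_top _ _))).symm

lemma integrable_kernel_real_mul {A B : Set Ω} (hA : MeasurableSet A) (hB : MeasurableSet B) :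
    Integrable (fun x => (q x).real A * (q x).real B) π := by
  have hm : Measurable fun x => (q x).real A * (q x).real B :=
    (q.measurable_coe hA).ennreal_toReal.mul (q.measurable_coe hB).ennreal_toReal
  refine Integrable.of_bound hm.aestronglyMeasurable 1 (ae_of_all _ fun x => ?_)
  rw [Real.norm_of_nonneg (by positivity)]
  exact mul_le_one₀ measureReal_le_one measureReal_nonneg measureReal_le_one

/-- If the two-step flow out of `A` is small, then a step of the chain moves from
`{x | 1/2 < q(x, A)}` to `A` and from its complement to `Aᶜ`, up to a small error. -/
lemma edge_mismatch_le (h : q.IsReversible π) {A B : Set Ω} (hA : MeasurableSet A)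
    (hB : MeasurableSet B) (hBA : ∀ x, x ∈ B ↔ 1 / 2 < (q x).real A) :
    (π ⊗ₘ q).real (B ×ˢ Aᶜ) + (π ⊗ₘ q).real (Bᶜ ×ˢ A)
      ≤ 2 * (π ⊗ₘ (q ^ 2 : Kernel Ω Ω)).real (A ×ˢ Aᶜ) := by
  have hi := integrable_kernel_real_mul (π := π) (q := q) hA hA.compl
  have hint {C : Set Ω} (hC : MeasurableSet C) : Integrable (fun x => (q x).real C) π := by
    simpa using integrable_kernel_real_mul (π := π) (q := q) hC MeasurableSet.univ
  rw [edge_sq_real_prod h hA hA.compl, ← integral_add_compl hB hi, mul_add,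
    ← setIntegral_kernel_real hB hA.compl, ← setIntegral_kernel_real hB.compl hA,
    ← integral_const_mul, ← integral_const_mul]
  -- On `B` the factor `q(x, A)` is above 1/2, off `B` the factor `q(x, Aᶜ)` is at least 1/2; twice
  -- the product dominates the remaining factor.
  refine add_le_add
    (setIntegral_mono_on (hint hA.compl).integrableOn (hi.const_mul 2).integrableOn hB
      fun x hx => ?_)
    (setIntegral_mono_on (hint hA).integrableOn (hi.const_mul 2).integrableOn hB.compl
      fun x hx => ?_)
  · nlinarith [(hBA x).1 hx, measureReal_nonneg (μ := q x) (s := Aᶜ)]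
  · have hs := probReal_add_probReal_compl (μ := q x) hA
    have : ¬ 1 / 2 < (q x).real A := fun h' => hx ((hBA x).2 h')
    nlinarith [measureReal_nonneg (μ := q x) (s := A)]

/-- The three comparisons between the flows out of `A` and out of `A ∆ B`, in terms of the mass of
the edges along which membership in `B` and in `A` disagree. -/
lemma edge_symmDiff_bounds (h : q.IsReversible π) {A B : Set Ω} (hA : MeasurableSet A)
    (hB : MeasurableSet B) :
    (π ⊗ₘ q).real (symmDiff A B ×ˢ (symmDiff A B)ᶜ)
        ≤ 2 * ((π ⊗ₘ q).real (B ×ˢ Aᶜ) + (π ⊗ₘ q).real (Bᶜ ×ˢ A)) ∧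
      2 * (π ⊗ₘ q).real (A ×ˢ Aᶜ)
        ≤ π.real (symmDiff A B) + ((π ⊗ₘ q).real (B ×ˢ Aᶜ) + (π ⊗ₘ q).real (Bᶜ ×ˢ A)) ∧
      1 ≤ 2 * (π ⊗ₘ q).real (A ×ˢ Aᶜ) + π.real (symmDiff A B)ᶜ
        + ((π ⊗ₘ q).real (B ×ˢ Aᶜ) + (π ⊗ₘ q).real (Bᶜ ×ˢ A)) := by
  have hE : MeasurableSet (symmDiff A B) := hA.symmDiff hB
  -- Off `L`, `y ∈ A` iff `x ∈ B`; hence an edge crosses `A` exactly when it starts in `A ∆ B`. If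
  -- the reversed edge is off `L` too, both endpoints lie in `A ∆ B` or neither does.
  set L : Set (Ω × Ω) := B ×ˢ Aᶜ ∪ Bᶜ ×ˢ A with hL
  have hLle : (π ⊗ₘ q).real L ≤ (π ⊗ₘ q).real (B ×ˢ Aᶜ) + (π ⊗ₘ q).real (Bᶜ ×ˢ A) :=
    measureReal_union_le _ _
  have hLswap : (π ⊗ₘ q).real (Aᶜ ×ˢ B ∪ A ×ˢ Bᶜ)
      ≤ (π ⊗ₘ q).real (B ×ˢ Aᶜ) + (π ⊗ₘ q).real (Bᶜ ×ˢ A) := by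
    rw [edge_real_prod_comm h hB hA.compl, edge_real_prod_comm h hB.compl hA]
    exact measureReal_union_le _ _
  have hAA : (π ⊗ₘ q).real (A ×ˢ Aᶜ ∪ Aᶜ ×ˢ A) = 2 * (π ⊗ₘ q).real (A ×ˢ Aᶜ) := by
    rw [measureReal_union _ (hA.compl.prod hA), edge_real_prod_comm h hA.compl hA]
    · ring
    · rw [Set.disjoint_left]
      rintro z ⟨h1, -⟩ ⟨h2, -⟩
      exact h2 h1
  refine ⟨?_, ?_, ?_⟩
  · have hsub : symmDiff A B ×ˢ (symmDiff A B)ᶜ ⊆ L ∪ (Aᶜ ×ˢ B ∪ A ×ˢ Bᶜ) := by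
      intro z
      simp only [hL, Set.mem_prod, Set.mem_union, Set.mem_compl_iff, Set.mem_symmDiff]
      tauto
    have := (measureReal_mono (μ := π ⊗ₘ q) hsub).trans (measureReal_union_le _ _)
    linarith
  · have hsub : A ×ˢ Aᶜ ∪ Aᶜ ×ˢ A ⊆ symmDiff A B ×ˢ Set.univ ∪ L := by
      intro z
      simp only [hL, Set.mem_prod, Set.mem_union, Set.mem_compl_iff, Set.mem_symmDiff,
        Set.mem_univ]
      tauto
    have := (measureReal_mono (μ := π ⊗ₘ q) hsub).trans (measureReal_union_le _ _)
    rw [hAA, edge_real_prod_univ hE] at this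
    linarith
  · have hsub : Set.univ ⊆ (A ×ˢ Aᶜ ∪ Aᶜ ×ˢ A) ∪ ((symmDiff A B)ᶜ ×ˢ Set.univ ∪ L) := by
      intro z
      simp only [hL, Set.mem_prod, Set.mem_union, Set.mem_compl_iff, Set.mem_symmDiff,
        Set.mem_univ]
      tauto
    have h1 := (measureReal_mono (μ := π ⊗ₘ q) hsub).trans (measureReal_union_le _ _)
    have h2 := measureReal_union_le (μ := π ⊗ₘ q) ((symmDiff A B)ᶜ ×ˢ Set.univ) L
    rw [hAA, probReal_univ] at h1
    rw [edge_real_prod_univ hE.compl] at h2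
    linarith

end TwoStep

/-! ### Numerical inequalities behind the lower bound for `k₂` -/

section Arithmetic

lemma third_term_le {k K δ ε₁ ε₂ ε : ℝ} (hk : 0 < k) (hkK : k ≤ K)
    (hδ : δ ∈ Set.Ioo (0 : ℝ) 1) (h₁ : ε₁ ∈ Set.Ioo (0 : ℝ) 1) (h₂ : ε₂ ∈ Set.Ioo (0 : ℝ) 1)
    (hε : ε ∈ Set.Ioo (0 : ℝ) 1)
    (hpos : 0 < (k * ((2 - ε) * (1 - ε₁) * (1 - ε₂) * (1 - δ) / ((1 - ε) * K) - 1 / (1 - ε))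
      - ε / (1 - ε)) * ε) :
    (k * ((2 - ε) * (1 - ε₁) * (1 - ε₂) * (1 - δ) / ((1 - ε) * K) - 1 / (1 - ε))
      - ε / (1 - ε)) * ε ≤ 2 - δ - K := by
  obtain ⟨hδ0, hδ1⟩ := hδ
  obtain ⟨h₁0, h₁1⟩ := h₁
  obtain ⟨h₂0, h₂1⟩ := h₂
  obtain ⟨hε0, hε1⟩ := hε
  have hK : 0 < K := hk.trans_le hkK
  have hε' : 0 < 1 - ε := by linarith
  set X := (2 - ε) * (1 - ε₁) * (1 - ε₂) * (1 - δ) with hX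
  have hXle : X ≤ (2 - ε) * (1 - δ) := by
    have h12 : (1 - ε₁) * (1 - ε₂) ≤ 1 := by nlinarith
    have : 0 ≤ (2 - ε) * (1 - δ) := mul_nonneg (by linarith) (by linarith)
    nlinarith
  have e : (k * (X / ((1 - ε) * K) - 1 / (1 - ε)) - ε / (1 - ε)) * ε
      = ε * (k * (X / K - 1) - ε) / (1 - ε) := by
    field_simp
  rw [e] at hpos ⊢
  have hY : 0 < k * (X / K - 1) - ε := by
    by_contra! hn
    exact absurd hpos (not_lt.2 (div_nonpos_of_nonpos_of_nonneg
      (mul_nonpos_of_nonneg_of_nonpos hε0.le hn) hε'.le))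
  have hXK : 0 < X / K - 1 := by
    by_contra! hn
    nlinarith
  -- The positive factor `X / K - 1` lets `k` be replaced by `K`, which clears the quotient.
  have hY2 : k * (X / K - 1) - ε ≤ (2 - ε) * (1 - δ) - K - ε := by
    have h1 : k * (X / K - 1) ≤ K * (X / K - 1) := mul_le_mul_of_nonneg_right hkK hXK.le
    have h2 : K * (X / K - 1) = X - K := by field_simp
    linarith
  rw [div_le_iff₀ hε']
  refine (mul_le_mul_of_nonneg_left hY2 hε0.le).trans ?_
  have hY3 : 0 < (2 - ε) * (1 - δ) - K - ε := hY.trans_le hY2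
  have h5 : 0 ≤ ε * (1 - ε) := by positivity
  rcases le_total ε (1 / 2) with hc | hc
  · nlinarith [mul_nonneg (sub_nonneg.2 hc) hY3.le, mul_nonneg hδ0.le (sq_nonneg (1 - ε))]
  · have h3 : 0 ≤ 3 * ε - 1 - ε ^ 2 := by nlinarith
    nlinarith [mul_nonneg (sub_nonneg.2 hc) hK.le, mul_nonneg hδ0.le h3, sq_nonneg (1 - ε)]

/-- Here `M` and `kA` stand for the two-step and one-step flows out of `A`, `s` for `π(A) π(Aᶜ)`,
`e` for the mass of `A ∆ B` and `L` for the mismatch. The first and third entries of the minimum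
already give the contradiction. -/
lemma lowerTerm_le_of_bounds {k K M s e L kA δ ε₁ ε₂ ε : ℝ} (hk0 : 0 ≤ k) (hk2 : k ≤ 2)
    (hkA : k ≤ kA) (hkK : kA ≤ K) (hM : 0 ≤ M) (hs : 0 < s) (hs4 : s ≤ 1 / 4) (he : e ≤ 1)
    (hδ : δ ∈ Set.Ioo (0 : ℝ) 1) (h₁ : ε₁ ∈ Set.Ioo (0 : ℝ) 1) (h₂ : ε₂ ∈ Set.Ioo (0 : ℝ) 1)
    (hε : ε ∈ Set.Ioo (0 : ℝ) 1) (hL : L ≤ 2 * (M * s)) (hE : k * (e * (1 - e)) ≤ 2 * L)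
    (hup : 2 * (kA * s) ≤ e + L) (hlow : 1 ≤ 2 * (kA * s) + (1 - e) + L) :
    lowerTerm k K δ ε₁ ε₂ ε ≤ M := by
  by_contra! hlt
  rw [lowerTerm, lt_min_iff, lt_min_iff] at hlt
  obtain ⟨hfst, -, hthird⟩ := hlt
  -- For `k = 0` the first entry is 0 and cannot exceed `M`. This also excludes `K = 0`, where the
  -- division takes its default value.
  have hk : 0 < k := by
    refine hk0.lt_of_ne fun h => ?_
    rw [← h] at hfst
    norm_num at hfst
    linarith
  have hthird' := hthird.trans_le
    (third_term_le hk (hkA.trans hkK) hδ h₁ h₂ hε (hM.trans_lt hthird))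
  obtain ⟨hδ0, hδ1⟩ := hδ
  have hM8 : M ≤ k / 8 := by
    have : k ^ 2 * δ ≤ 2 * k := by
      have : k * δ ≤ 2 := by nlinarith
      nlinarith
    linarith
  have he1 : 7 / 4 * k * s ≤ e := by nlinarith
  have h1e : 0 ≤ 1 - e := sub_nonneg.2 he
  have hke : k * (7 / 4 * k * s * (1 - e)) ≤ 4 * (M * s) := by
    have := mul_le_mul_of_nonneg_left (mul_le_mul_of_nonneg_right he1 h1e) hk0
    linarith
  have hke' : 7 / 4 * k ^ 2 * (1 - e) ≤ 4 * M := by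
    refine le_of_mul_le_mul_right ?_ hs
    linarith
  -- From `M < k²δ/16`: `A ∆ B` has nearly full mass. With `s ≤ 1/4`, `hlow` then forces `K + M ≥ 2
  -- - 2δ/7`, whereas the third entry gives `M < 2 - δ - K`.
  have hed : 1 - e ≤ δ / 7 := by
    by_contra! hcon
    have : 7 / 4 * k ^ 2 * (δ / 7) < 7 / 4 * k ^ 2 * (1 - e) :=
      mul_lt_mul_of_pos_left hcon (by positivity)
    linarith
  have hfin : 1 ≤ 2 * (K + M) * s + δ / 7 := by nlinarith
  have : (K + M) * s ≤ (K + M) * (1 / 4) :=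
    mul_le_mul_of_nonneg_left hs4 (by linarith)
  linarith

lemma exists_lowerTerm_pos {k K : ℝ} (hk : 0 < k) (hkK : k ≤ K) (hK : K < 2) :
    ∃ t ∈ lowerTerms k K, 0 < t := by
  have hK0 : 0 < K := hk.trans_le hkK
  -- All `ε`s equal `η` and `δ = η³`, so that `δ` is negligible against `ε₁ε₂ = η²`. The third entry
  -- loses at most `η(7k + K) < 16η`, less than the available `k(2 - K) = 32η`.
  set η := k * (2 - K) / 32 with hη
  have hη0 : 0 < η := by
    have : 0 < 2 - K := by linarith
    positivity
  have hη1 : η ≤ 1 / 8 := by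
    have : k * (2 - K) ≤ 2 * 2 := mul_le_mul (by linarith) (by linarith) (by linarith) (by norm_num)
    linarith
  have hη3 : η ^ 3 ≤ η := by
    have : η ^ 3 ≤ η ^ 1 := pow_le_pow_of_le_one hη0.le (by linarith) (by norm_num)
    simpa using this
  have hηI : η ∈ Set.Ioo (0 : ℝ) 1 := ⟨hη0, by linarith⟩
  have hηI3 : η ^ 3 ∈ Set.Ioo (0 : ℝ) 1 := ⟨by positivity, by linarith⟩
  refine ⟨_, ⟨η ^ 3, hηI3, η, hηI, η, hηI, η, hηI, rfl⟩, ?_⟩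
  rw [lowerTerm, lt_min_iff, lt_min_iff]
  refine ⟨by positivity, mul_pos (by positivity) ?_, mul_pos ?_ hη0⟩
  · have : 0 < η ^ 2 * (1 - η ^ 3 - η) := mul_pos (by positivity) (by linarith)
    linarith
  · have hε' : 0 < 1 - η := by linarith
    set X := (2 - η) * (1 - η) * (1 - η) * (1 - η ^ 3) with hX
    have hXge : 2 - 7 * η ≤ X := by
      have h1 : 2 - 5 * η ≤ (2 - η) * (1 - η) * (1 - η) := by nlinarith
      have h2 : (2 - 5 * η) * (1 - η) ≤ X :=
        mul_le_mul h1 (by linarith) (by linarith) (by nlinarith)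
      nlinarith
    have e : k * (X / ((1 - η) * K) - 1 / (1 - η)) - η / (1 - η)
        = (k * (X - K) - η * K) / ((1 - η) * K) := by
      field_simp
    rw [e]
    refine div_pos ?_ (by positivity)
    have h1 : k * (2 - 7 * η - K) ≤ k * (X - K) := mul_le_mul_of_nonneg_left (by linarith) hk.le
    have h2 : η * (7 * k + K) < η * 32 := mul_lt_mul_of_pos_left (by linarith) hη0
    have h3 : η * 32 = k * (2 - K) := by rw [hη]; ring
    linarith

end Arithmetic

/-! ### The isoperimetric constants of a reversible chain -/

section Constants

variable {𝕜 : Type*} [RCLike 𝕜] {Ω : Type*} [MeasurableSpace Ω] {π : Measure Ω}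
  [IsProbabilityMeasure π] {p : Kernel Ω Ω} [IsMarkovKernel p]

lemma flow_one_mul {A : Set Ω} (hA : A ∈ properSets π) :
    flow p π 1 A * (π.real A * π.real Aᶜ) = (π ⊗ₘ p).real (A ×ˢ Aᶜ) := by
  have : IsMarkovKernel (p ^ 1 : Kernel Ω Ω) := by rw [pow_one]; infer_instance
  rw [flow_mul hA, pow_one]

lemma isoConst_one_mul_le {A : Set Ω} (hA : MeasurableSet A) :
    isoConst p π 1 * (π.real A * π.real Aᶜ) ≤ (π ⊗ₘ p).real (A ×ˢ Aᶜ) := by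
  have : IsMarkovKernel (p ^ 1 : Kernel Ω Ω) := by rw [pow_one]; infer_instance
  simpa only [pow_one] using isoConst_mul_le (q := p) (π := π) 1 hA

lemma flow_one_le_two (h : p.IsReversible π) {A : Set Ω} (hA : A ∈ properSets π) :
    flow p π 1 A ≤ 2 := by
  have : IsMarkovKernel (p ^ 1 : Kernel Ω Ω) := by rw [pow_one]; infer_instance
  exact flow_le_two (by rwa [pow_one]) hA

lemma flow_one_le_supConst (h : p.IsReversible π) {A : Set Ω} (hA : A ∈ properSets π) :
    flow p π 1 A ≤ supConst p π :=
  le_csSup ⟨2, by rintro _ ⟨B, hB, rfl⟩; exact flow_one_le_two h hB⟩ ⟨A, hA, rfl⟩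

lemma isoConst_two_sq_le (h : p.IsReversible π)
    (hπ : ∃ A : Set Ω, MeasurableSet A ∧ 0 < π A ∧ π A < 1) :
    36 / 25 / 8 * isoConst p π 2 ^ 2 ≤ 1 := by
  obtain ⟨A, hA⟩ := hπ
  have h2 : isoConst p π 2 ≤ 2 :=
    (isoConst_le_flow 2 hA).trans (flow_le_two (isReversible_sq h) hA)
  nlinarith [isoConst_nonneg (q := p) (π := π) 2]

lemma lowerTerms_le (h : p.IsReversible π)
    (hπ : ∃ A : Set Ω, MeasurableSet A ∧ 0 < π A ∧ π A < 1) {t : ℝ}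
    (ht : t ∈ lowerTerms (isoConst p π 1) (supConst p π)) : t ≤ isoConst p π 2 := by
  obtain ⟨δ, hδ, ε₁, h₁, ε₂, h₂, ε, hε, rfl⟩ := ht
  refine le_csInf (Set.Nonempty.image _ hπ) ?_
  rintro _ ⟨A, hA, rfl⟩
  have hAm : MeasurableSet A := hA.1
  obtain ⟨ha, hb, hab⟩ := real_pos_of_mem_properSets hA
  have hB : MeasurableSet {x | 1 / 2 < (p x).real A} :=
    measurableSet_lt measurable_const (p.measurable_coe hAm).ennreal_toReal
  have hmis := edge_mismatch_le h hAm hB fun _ => Iff.rfl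
  obtain ⟨e1, e2, e3⟩ := edge_symmDiff_bounds h hAm hB
  have hE := hAm.symmDiff hB
  have hEc := probReal_compl_eq_one_sub (μ := π) hE
  have hiso := isoConst_one_mul_le (p := p) (π := π) hE
  rw [← flow_mul (n := 2) hA] at hmis
  rw [← flow_one_mul hA] at e2 e3
  rw [hEc] at e3 hiso
  exact lowerTerm_le_of_bounds (isoConst_nonneg 1)
    ((isoConst_le_flow 1 hA).trans (flow_one_le_two h hA)) (isoConst_le_flow 1 hA)
    (flow_one_le_supConst h hA) (flow_nonneg 2 A) (mul_pos ha hb)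
    (by nlinarith [sq_nonneg (π.real A - π.real Aᶜ)]) measureReal_le_one hδ h₁ h₂ hε hmis
    (hiso.trans e1) e2 e3

lemma iso_bounds_of_hasSpectralGap (h : p.IsReversible π)
    (hπ : ∃ A : Set Ω, MeasurableSet A ∧ 0 < π A ∧ π A < 1)
    (hgap : HasSpectralGap 𝕜 h.invariant) :
    0 < isoConst p π 1 ∧ isoConst p π 1 ≤ supConst p π ∧ supConst p π < 2 := by
  obtain ⟨r, hr, hP⟩ := norm_le_of_hasSpectralGap h hgap
  have key {A : Set Ω} (hA : A ∈ properSets π) : r ≤ flow p π 1 A ∧ flow p π 1 A ≤ 2 - r := by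
    obtain ⟨ha, hb, -⟩ := real_pos_of_mem_properSets hA
    have hab : 0 < π.real A * π.real Aᶜ := mul_pos ha hb
    set f := centeredIndicator 𝕜 π hA.1 with hf
    have h1 := re_inner_centeredIndicator (𝕜 := 𝕜) h hA.1
    rw [← hf, ← flow_one_mul hA] at h1
    have h2 : ‖f‖ ^ 2 = π.real A * π.real Aᶜ := norm_sq_centeredIndicator hA.1
    have h3 : |RCLike.re (inner 𝕜 f (markovOp 𝕜 h.invariant f))|
        ≤ (1 - r) * (π.real A * π.real Aᶜ) := by
      rw [← h2]
      refine (RCLike.abs_re_le_norm _).trans ((norm_inner_le_norm _ _).trans ?_)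
      have := mul_le_mul_of_nonneg_left (hP f (centeredIndicator_mem hA.1)) (norm_nonneg f)
      linarith
    rw [h1, abs_le] at h3
    constructor
    · refine le_of_mul_le_mul_right ?_ hab
      linarith [h3.2]
    · refine le_of_mul_le_mul_right ?_ hab
      linarith [h3.1]
  have hne : (flow p π 1 '' properSets π).Nonempty := Set.Nonempty.image _ hπ
  refine ⟨hr.trans_le (le_csInf hne ?_), ?_, (csSup_le hne ?_).trans_lt (sub_lt_self 2 hr)⟩
  · rintro _ ⟨A, hA, rfl⟩
    exact (key hA).1
  · obtain ⟨A, hA⟩ := hπ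
    exact (isoConst_le_flow 1 hA).trans (flow_one_le_supConst h hA)
  · rintro _ ⟨A, hA, rfl⟩
    exact (key hA).2

lemma norm_markovOp_le (h : p.IsReversible π) {f : Lp 𝕜 2 π} (hf : f ∈ L2Zero 𝕜 π) :
    ‖markovOp 𝕜 h.invariant f‖ ≤ √(1 - 36 / 25 / 8 * isoConst p π 2 ^ 2) * ‖f‖ := by
  have h1 := cheeger_L2Zero (isReversible_sq h) (isoConst_nonneg 2)
    (fun A hA => isoConst_mul_le (q := p) (π := π) 2 hA) hf
  rw [re_inner_markovOp_sq h] at h1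
  -- Splitting the root only needs `‖f‖² ≥ 0`, not the sign of the other factor.
  refine Real.le_sqrt_of_sq_le h1 |>.trans (le_of_eq ?_)
  rw [Real.sqrt_mul' _ (sq_nonneg _), Real.sqrt_sq (norm_nonneg _)]

lemma hasSpectralGap_of_isoConst_two_pos (h : p.IsReversible π) (h2 : 0 < isoConst p π 2) :
    HasSpectralGap 𝕜 h.invariant := by
  refine hasSpectralGap_of_norm_le h (s := √(1 - 36 / 25 / 8 * isoConst p π 2 ^ 2)) ?_
    fun f hf => norm_markovOp_le h hf
  rw [Real.sqrt_lt' one_pos, one_pow]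
  have : 0 < 36 / 25 / 8 * isoConst p π 2 ^ 2 := by positivity
  linarith

lemma inner_markovOpZero_right (h : p.Invariant π) (f g : L2Zero 𝕜 π) :
    inner 𝕜 f (markovOpZero 𝕜 h g) = inner 𝕜 (f : Lp 𝕜 2 π) (markovOp 𝕜 h (g : Lp 𝕜 2 π)) := by
  rw [Submodule.coe_inner]
  rfl

lemma inner_markovOpZero_left (h : p.Invariant π) (f g : L2Zero 𝕜 π) :
    inner 𝕜 (markovOpZero 𝕜 h f) g = inner 𝕜 (markovOp 𝕜 h (f : Lp 𝕜 2 π)) (g : Lp 𝕜 2 π) := by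
  rw [Submodule.coe_inner]
  rfl

lemma spectrum_markovOpZero_subset (h : p.IsReversible π) :
    spectrum 𝕜 (markovOpZero 𝕜 h.invariant) ⊆ (fun t : ℝ => (t : 𝕜)) '' Set.Icc
      (-√(1 - 36 / 25 / 8 * isoConst p π 2 ^ 2))
      (min (√(1 - 36 / 25 / 8 * isoConst p π 2 ^ 2)) (1 - 36 / 25 / 8 * isoConst p π 1 ^ 2)) := by
  have habs (f : L2Zero 𝕜 π) :
      |RCLike.re (inner 𝕜 (f : Lp 𝕜 2 π) (markovOp 𝕜 h.invariant (f : Lp 𝕜 2 π)))|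
        ≤ √(1 - 36 / 25 / 8 * isoConst p π 2 ^ 2) * ‖f‖ ^ 2 := by
    refine (RCLike.abs_re_le_norm _).trans ((norm_inner_le_norm _ _).trans ?_)
    have := mul_le_mul_of_nonneg_left (norm_markovOp_le h f.2) (norm_nonneg (f : Lp 𝕜 2 π))
    rw [Submodule.coe_norm]
    linarith
  refine spectrum_subset_of_numerical_range
    (fun f g => by
      rw [inner_markovOpZero_left, inner_markovOpZero_right]
      exact inner_markovOp_left h (f : Lp 𝕜 2 π) (g : Lp 𝕜 2 π))
    (fun f => ?_) fun f => ?_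
  · rw [inner_markovOpZero_right, neg_mul]
    exact (abs_le.1 (habs f)).1
  · rw [inner_markovOpZero_right, min_mul_of_nonneg _ _ (sq_nonneg _)]
    have h2 := cheeger_L2Zero h (isoConst_nonneg 1) (fun A hA => isoConst_one_mul_le hA) f.2
    exact le_min (abs_le.1 (habs f)).2 h2

end Constants

end ReversibleChain

theorem theorem2 :
    ∃ κ : ℝ, 1 < κ ∧
      ∀ (𝕜 : Type*) [RCLike 𝕜] (Ω : Type*) [MeasurableSpace Ω]
        (π : Measure Ω) [IsProbabilityMeasure π]
        (p : Kernel Ω Ω) [IsMarkovKernel p] (hrev : p.IsReversible π)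
        (_hπ : ∃ A : Set Ω, MeasurableSet A ∧ 0 < π A ∧ π A < 1),
        -- the three equivalent conditions
        List.TFAE
          [ReversibleChain.HasSpectralGap 𝕜 hrev.invariant,
            0 < ReversibleChain.isoConst p π 1 ∧
              ReversibleChain.isoConst p π 1 ≤ ReversibleChain.supConst p π ∧
              ReversibleChain.supConst p π < 2,
            0 < ReversibleChain.isoConst p π 2] ∧
        -- the location of the spectrum (the square roots are taken of nonnegative numbers)
        κ / 8 * ReversibleChain.isoConst p π 2 ^ 2 ≤ 1 ∧
        spectrum 𝕜 (ReversibleChain.markovOpZero 𝕜 hrev.invariant) ⊆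
          (fun t : ℝ => (t : 𝕜)) '' Set.Icc
            (-√(1 - κ / 8 * ReversibleChain.isoConst p π 2 ^ 2))
            (min (√(1 - κ / 8 * ReversibleChain.isoConst p π 2 ^ 2))
              (1 - κ / 8 * ReversibleChain.isoConst p π 1 ^ 2)) ∧
        -- the lower bound for `k₂`
        BddAbove (ReversibleChain.lowerTerms (ReversibleChain.isoConst p π 1)
          (ReversibleChain.supConst p π)) ∧
        sSup (ReversibleChain.lowerTerms (ReversibleChain.isoConst p π 1)
          (ReversibleChain.supConst p π)) ≤ ReversibleChain.isoConst p π 2 := by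
  refine ⟨36 / 25, by norm_num, fun 𝕜 _ Ω _ π _ p _ hrev hπ => ?_⟩
  have hlower : ∀ t ∈ ReversibleChain.lowerTerms (ReversibleChain.isoConst p π 1)
      (ReversibleChain.supConst p π), t ≤ ReversibleChain.isoConst p π 2 :=
    fun t ht => ReversibleChain.lowerTerms_le hrev hπ ht
  have h23 : 0 < ReversibleChain.isoConst p π 1 ∧
      ReversibleChain.isoConst p π 1 ≤ ReversibleChain.supConst p π ∧
        ReversibleChain.supConst p π < 2 → 0 < ReversibleChain.isoConst p π 2 := by
    rintro ⟨hk, hkK, hK⟩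
    obtain ⟨t, ht, ht0⟩ := ReversibleChain.exists_lowerTerm_pos hk hkK hK
    exact ht0.trans_le (hlower t ht)
  refine ⟨?_, ReversibleChain.isoConst_two_sq_le hrev hπ,
    ReversibleChain.spectrum_markovOpZero_subset hrev, ⟨_, hlower⟩, csSup_le ?_ hlower⟩
  · tfae_have 1 → 2 := ReversibleChain.iso_bounds_of_hasSpectralGap hrev hπ
    tfae_have 2 → 3 := h23
    tfae_have 3 → 1 := ReversibleChain.hasSpectralGap_of_isoConst_two_pos hrev
    tfae_finish
  -- Bounding the supremum from above requires a nonempty set; any admissible parameters serve.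
  · exact ⟨_, 1 / 2, by norm_num, 1 / 2, by norm_num, 1 / 2, by norm_num, 1 / 2, by norm_num, rfl⟩
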